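/- **The problem (CLTSP with slow clients, general processing times, no time constraints).** A server starts at time $0$ at the origin of the real line and moves at speed at most $1$. There is a set $A$ of $n\ge 1$ clients that move at speed at most $v$, where $0<v<1$. Client $a\in A$ is at position $s(a)\in\mathbb R$ at time $0$ and has a processing time $\tau(a)\ge 0$; there are no release dates and no deadlines. A solution consists of an order $\sigma_1,\dots,\sigma_n$ of the clients, a rendezvous time $t(a)$ and position $x(a)$ for each $a\in A$, and an end time $t_{n+1}$. Write $t_i=t(\sigma_i)$, $x_i=x(\sigma_i)$, $c_i=t_i+\tau(\sigma_i)$ for $1\le i\le n$, and $c_0=0$, $x_0=x_{n+1}=0$. The solution is feasible if $t_i\ge c_{i-1}+|x_i-x_{i-1}|$ for $1\le i\le n+1$ and $t(a)\ge |x(a)-s(a)|/v$ for all $a$. Its makespan is $t_{n+1}$. It is optimal if it is feasible and of minimum makespan. **Algorithm 2.** Let $L=\{a: s(a)\le 0\}$ and $R=\{a: s(a)>0\}$, and let $\ell(1),\dots,\ell(n_L)$ and $r(1),\dots,r(n_R)$ be their elements sorted by non-decreasing $|s|$. For states $S=(i,j,d)$ with $0\le i\le n_L$, $0\le j\le n_R$,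 $d\in\{L,R\}$, the table entry $D(i,j,L)$ is the time of a direct rendezvous with $\ell(i)$ after $\ell(1),\dots,\ell(i-1),r(1),\dots,r(j)$ have been processed, and $D(i,j,R)$ that of a direct rendezvous with $r(j)$ after $\ell(1),\dots,\ell(i),r(1),\dots,r(j-1)$ have been processed. Initially $D(1,0,L)=|s(\ell(1))|/(1+v)$ and $D(0,1,R)=|s(r(1))|/(1+v)$ (if these clients exist); all other entries, and the final values $F(L),F(R)$, are $\infty$. The states $S'=(i',j',d')$ with $D(S')<\infty$ are expanded in lexicographic order: * Let $X=s(\ell(i'))+vD(S')$ if $d'=L$ and $X=s(r(j'))-vD(S')$ if $d'=R$. The server processes the client of the direct rendezvous at $X$. While it is busy, further clients may arrive at $X$, where $\ell(k)$ arrives at time $(X-s(\ell(k)))/v$ and $r(k)$ at time $(s(r(k))-X)/v$; they are processed one after the other in the order of arrival, which keeps the server busy for longer, until the next client arrives only after the server has become idle. Let $T$ be the time at which the server becomes idle, and let $\ell(1),\dots,\ell(i'')$ and $r(1),\dots,r(j'')$ be the clients processed by then. * If $i''=n_L$ and $j''=n_R$, then $F(d')$ is replaced by $\min\{F(d'),\,T+|X|\}$.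 * Otherwise, if $i''<n_L$, then $D(i''+1,j'',L)$ is replaced by the minimum of itself and $T+|X-(s(\ell(i''+1))+vT)|/(1+v)$, and, if $j''<n_R$, then $D(i'',j''+1,R)$ is replaced by the minimum of itself and $T+|X-(s(r(j''+1))-vT)|/(1+v)$. The algorithm returns $\min\{F(L),F(R)\}$, together with the schedule (the sequence of clients with rendezvous times and positions) that attains it and that is recorded along with the table entries. **Theorem.** For every such instance with $n\ge 1$ clients, Algorithm 2 (including the sorting of the clients) solves the CLTSP: the returned value is the minimum makespan, and the returned schedule is that of an optimal solution. It does so in $O(n^3)$ time: there is an absolute constant $C$ such that on every instance it performs at most $Cn^3$ elementary steps on a unit-cost real RAM (real arithmetic, comparisons, index arithmetic and memory accesses each cost one step). -/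

import Mathlib

noncomputable section

namespace CLTSP

/-! ## The problem -/

/-- An instance with client set `A = Fin n`: the speed `v` of the clients and, for every client,
its initial position `s`, release date `r`, deadline `d` (possibly `⊤`, i.e. infinite) and
processing time `τ`. -/
structure Instance (n : ℕ) where
  v : ℝ
  s : Fin n → ℝ
  r : Fin n → ℝ
  d : Fin n → WithTop ℝ
  τ : Fin n → ℝ
  v_nonneg : 0 ≤ v
  r_nonneg : ∀ a, 0 ≤ r a
  d_nonneg : ∀ a, 0 ≤ d a
  τ_nonneg : ∀ a, 0 ≤ τ a

/-- Slow clients: they are strictly slower than the server, whose speed is `1`. -/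
def Instance.SlowClients {n : ℕ} (I : Instance n) : Prop := 0 < I.v ∧ I.v < 1

/-- No time constraints. -/
def Instance.NoTimeConstraints {n : ℕ} (I : Instance n) : Prop :=
  ∀ a, I.r a = 0 ∧ I.d a = ⊤

/-- A solution: `(time a, pos a)` is the rendezvous of the server with client `a`, the server's
`(k+1)`-st rendezvous is with client `order k`, and `finish` is the time at which the server's
tour ends at the origin. -/
structure Solution (n : ℕ) where
  order : Equiv.Perm (Fin n)
  time : Fin n → ℝ
  pos : Fin n → ℝ
  finish : ℝ

/-- `t_0, ..., t_{n+1}`: the times of the server's start, its `n` rendezvous and its end. -/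
def Solution.t {n : ℕ} (S : Solution n) : ℕ → ℝ
  | 0 => 0
  | k + 1 => if h : k < n then S.time (S.order ⟨k, h⟩) else S.finish

/-- `x_0, ..., x_{n+1}`: the positions of the server's start, its `n` rendezvous and its end. -/
def Solution.x {n : ℕ} (S : Solution n) : ℕ → ℝ
  | 0 => 0
  | k + 1 => if h : k < n then S.pos (S.order ⟨k, h⟩) else 0

/-- `c_0, ..., c_{n+1}`: the completion times. -/
def Instance.c {n : ℕ} (I : Instance n) (S : Solution n) : ℕ → ℝ
  | 0 => 0
  | k + 1 => if h : k < n then S.time (S.order ⟨k, h⟩) + I.τ (S.order ⟨k, h⟩) else S.finish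

/-- Feasibility: the rendezvous and the return to the origin are reachable by the server, every
rendezvous is reachable by its client, and the time windows are respected. -/
structure Instance.Feasible {n : ℕ} (I : Instance n) (S : Solution n) : Prop where
  server : ∀ k ≤ n, I.c S k + |S.x (k + 1) - S.x k| ≤ S.t (k + 1)
  client : ∀ a, I.r a + |S.pos a - I.s a| / I.v ≤ S.time a
  release : ∀ a, I.r a ≤ S.time a
  deadline : ∀ a, (S.time a : WithTop ℝ) ≤ I.d a

/-- The makespan `C_max = c_{n+1}`. -/
def Instance.makespan {n : ℕ} (I : Instance n) (S : Solution n) : ℝ := I.c S (n + 1)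

/-- Optimal solutions of the CLTSP: feasible solutions of minimum makespan. -/
def Instance.IsOptimal {n : ℕ} (I : Instance n) (S : Solution n) : Prop :=
  I.Feasible S ∧ ∀ S', I.Feasible S' → I.makespan S ≤ I.makespan S'

/-- The rendezvous `(client, time, position)` of a solution, in the order of the server. -/
def Solution.schedule {n : ℕ} (S : Solution n) : List (Fin n × ℝ × ℝ) :=
  List.ofFn fun k => (S.order k, S.time (S.order k), S.pos (S.order k))

/-! ## The machine model

A real RAM with unit cost. A computation carries its result and the number of steps spent. The
algorithm below computes, compares, and accesses memory only through the primitives listed here,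
each of which has cost one, except for the four bulk operations on memory at the end of the list,
whose cost is the number of cells that they touch (plus one), and loops, which pay one additional
step in each iteration. -/

/-- A result together with the number of elementary steps spent to compute it. -/
structure Timed (α : Type) where
  val : α
  steps : ℕ

instance : Monad Timed where
  pure a := ⟨a, 0⟩
  bind m f := ⟨(f m.val).val, m.steps + (f m.val).steps⟩

namespace Timed

def tick : Timed Unit := ⟨(), 1⟩

/-- Real arithmetic. -/
def add (a b : ℝ) : Timed ℝ := ⟨a + b, 1⟩
def sub (a b : ℝ) : Timed ℝ := ⟨a - b, 1⟩
def mul (a b : ℝ) : Timed ℝ := ⟨a * b, 1⟩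
def div (a b : ℝ) : Timed ℝ := ⟨a / b, 1⟩
def abs (a : ℝ) : Timed ℝ := ⟨|a|, 1⟩

open Classical in
/-- Comparison of reals. -/
def le (a b : ℝ) : Timed Bool := ⟨decide (a ≤ b), 1⟩

/-- Index arithmetic. -/
def succ (i : ℕ) : Timed ℕ := ⟨i + 1, 1⟩
def pred (i : ℕ) : Timed ℕ := ⟨i - 1, 1⟩
def eq (i j : ℕ) : Timed Bool := ⟨decide (i = j), 1⟩

/-- Reading one entry of a part of the input that is given as a vector. -/
def fetch {n : ℕ} (f : Fin n → ℝ) (a : Fin n) : Timed ℝ := ⟨f a, 1⟩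

/-- Reading the cell `i` of an array; `none` if there is no such cell. -/
def read {α : Type} (arr : Array α) (i : ℕ) : Timed (Option α) := ⟨arr[i]?, 1⟩

/-- The length of an array. -/
def size {α : Type} (arr : Array α) : Timed ℕ := ⟨arr.size, 1⟩

/-- Prepending one entry to a linked list. -/
def cons {α : Type} (a : α) (l : List α) : Timed (List α) := ⟨a :: l, 1⟩

/-- The list `0, 1, ..., k` of the values of a loop counter. -/
def upTo (k : ℕ) : Timed (List ℕ) := ⟨List.range (k + 1), k + 2⟩

/-- The list of all clients. -/
def clients (n : ℕ) : Timed (List (Fin n)) := ⟨List.finRange n, n + 1⟩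

/-- Copying a list into an array. -/
def toArray {α : Type} (l : List α) : Timed (Array α) := ⟨l.toArray, l.length + 1⟩

/-- Reversing a list. -/
def reverse {α : Type} (l : List α) : Timed (List α) := ⟨l.reverse, l.length + 1⟩

/-- A loop over a list, with one step of overhead in each iteration. -/
def loop {α β : Type} (f : β → α → Timed β) : β → List α → Timed β
  | b, [] => pure b
  | b, a :: l => do
    tick
    let b' ← f b a
    loop f b' l

end Timed

open Timed

/-! ## The algorithm -/

/-- The two sides: `L` for the clients with `s(a) ≤ 0`, `R` for those with `s(a) > 0`. -/
inductive Side : Type where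
  | L : Side
  | R : Side
  deriving DecidableEq

/-- Insertion of a client into a list of clients sorted by distance from the origin. -/
def insertClient {n : ℕ} (I : Instance n) (a : Fin n) : List (Fin n) → Timed (List (Fin n))
  | [] => cons a []
  | b :: l => do
    let sa ← fetch I.s a
    let sb ← fetch I.s b
    let da ← Timed.abs sa
    let db ← Timed.abs sb
    if ← le da db then
      cons a (b :: l)
    else
      let l' ← insertClient I a l
      cons b l'

/-- Distributes a list of clients to the sides `L` and `R`, each sorted by distance from the
origin. -/
def sortSides {n : ℕ} (I : Instance n) : List (Fin n) → Timed (List (Fin n) × List (Fin n))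
  | [] => pure ([], [])
  | a :: l => do
    tick
    let (ls, rs) ← sortSides I l
    let sa ← fetch I.s a
    if ← le sa 0 then
      let ls' ← insertClient I a ls
      pure (ls', rs)
    else
      let rs' ← insertClient I a rs
      pure (ls, rs')

/-- The finite entries of the dynamic programming table: a time `time`, and the rendezvous
`(client, time, position)` made so far in the schedule that attains this time, the most recent one
first. The entry `∞` is represented by `none`. -/
structure Entry (n : ℕ) where
  time : ℝ
  past : List (Fin n × ℝ × ℝ)

/-- The smaller of two entries, where `none` stands for `∞`. -/
def better {n : ℕ} : Option (Entry n) → Option (Entry n) → Timed (Option (Entry n))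
  | none, e => do
    tick
    pure e
  | some e, none => do
    tick
    pure (some e)
  | some e, some e' => do
    if ← le e.time e'.time then
      pure (some e)
    else
      pure (some e')

/-- The memory of the dynamic program. `D i j d` is the entry of the state `(i, j, d)`. For `d = L`
its time is the least time, over the transitions examined so far, of a direct rendezvous with
`ℓ(i)` after `ℓ(1), ..., ℓ(i-1)` and `r(1), ..., r(j)` have been processed; for `d = R` that of a
direct rendezvous with `r(j)` after `ℓ(1), ..., ℓ(i)` and `r(1), ..., r(j-1)` have been processed.
`F d` is the final entry: all clients are processed, the server is back at the origin, and the
last direct rendezvous was with a client of side `d`. -/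
structure Table (n : ℕ) where
  D : ℕ → ℕ → Side → Option (Entry n)
  F : Side → Option (Entry n)

namespace Table

/-- The table with all entries `∞`, for `nL` clients in `L` and `nR` clients in `R`. -/
def init (n nL nR : ℕ) : Timed (Table n) :=
  ⟨⟨fun _ _ _ => none, fun _ => none⟩, 2 * (nL + 1) * (nR + 1) + 2⟩

def readD {n : ℕ} (M : Table n) (i j : ℕ) (d : Side) : Timed (Option (Entry n)) := ⟨M.D i j d, 1⟩

def readF {n : ℕ} (M : Table n) (d : Side) : Timed (Option (Entry n)) := ⟨M.F d, 1⟩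

def writeD {n : ℕ} (M : Table n) (i j : ℕ) (d : Side) (e : Option (Entry n)) : Timed (Table n) :=
  ⟨{ M with D := fun i' j' d' => if i' = i ∧ j' = j ∧ d' = d then e else M.D i' j' d' }, 1⟩

def writeF {n : ℕ} (M : Table n) (d : Side) (e : Option (Entry n)) : Timed (Table n) :=
  ⟨{ M with F := fun d' => if d' = d then e else M.F d' }, 1⟩

/-- Replaces the entry of the state `(i, j, d)` by the minimum of it and `e`. -/
def relaxD {n : ℕ} (M : Table n) (i j : ℕ) (d : Side) (e : Entry n) : Timed (Table n) := do
  let old ← M.readD i j d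
  let new ← better old (some e)
  M.writeD i j d new

/-- Replaces the final entry of side `d` by the minimum of it and `e`. -/
def relaxF {n : ℕ} (M : Table n) (d : Side) (e : Entry n) : Timed (Table n) := do
  let old ← M.readF d
  let new ← better old (some e)
  M.writeF d new

end Table

/-- The position at time `T` of the client `a` of side `d` if it moves towards the other side from
the start: `s(a) + v T` for `d = L` and `s(a) - v T` for `d = R`. -/
def clientPos {n : ℕ} (I : Instance n) (d : Side) (a : Fin n) (T : ℝ) : Timed ℝ := do
  let sa ← fetch I.s a
  let m ← mul I.v T
  match d with
  | Side.L => add sa m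
  | Side.R => sub sa m

/-- The time at which the client `a` of side `d` arrives at the position `X` if it moves towards
the other side from the start: `(X - s(a)) / v` for `d = L` and `(s(a) - X) / v` for `d = R`. -/
def arrival {n : ℕ} (I : Instance n) (d : Side) (a : Fin n) (X : ℝ) : Timed ℝ := do
  let sa ← fetch I.s a
  match d with
  | Side.L => do
    let y ← sub X sa
    div y I.v
  | Side.R => do
    let y ← sub sa X
    div y I.v

/-- The next client to arrive at `X` once `ℓ(1), ..., ℓ(i)` and `r(1), ..., r(j)` are processed,
with its side and arrival time. The arrays `ls` and `rs` hold `ℓ` and `r`; their indices start at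
`0`, so that `ls[i]` is `ℓ(i+1)`. -/
def nextArrival {n : ℕ} (I : Instance n) (ls rs : Array (Fin n)) (X : ℝ) (i j : ℕ) :
    Timed (Option (Side × Fin n × ℝ)) := do
  let oa ← read ls i
  let ob ← read rs j
  match oa, ob with
  | none, none => pure none
  | some a, none => do
    let ta ← arrival I Side.L a X
    pure (some (Side.L, a, ta))
  | none, some b => do
    let tb ← arrival I Side.R b X
    pure (some (Side.R, b, tb))
  | some a, some b => do
    let ta ← arrival I Side.L a X
    let tb ← arrival I Side.R b X
    if ← le ta tb then
      pure (some (Side.L, a, ta))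
    else
      pure (some (Side.R, b, tb))

/-- The server has processed `ℓ(1), ..., ℓ(i)` and `r(1), ..., r(j)` and becomes idle at time
`time`. -/
structure Progress (n : ℕ) where
  i : ℕ
  j : ℕ
  time : ℝ
  past : List (Fin n × ℝ × ℝ)

/-- The waiting rendezvous at the position `X`: as long as the next client arrives at `X` no later
than the time at which the server becomes idle, it is processed at that time, which keeps the
server busy for longer. The first argument bounds the number of iterations. -/
def cascade {n : ℕ} (I : Instance n) (ls rs : Array (Fin n)) (X : ℝ) :
    ℕ → Progress n → Timed (Progress n)
  | 0, p => pure p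
  | k + 1, p => do
    tick
    match ← nextArrival I ls rs X p.i p.j with
    | none => pure p
    | some (d, a, ta) => do
      if ← le ta p.time then
        let τa ← fetch I.τ a
        let T ← add p.time τa
        let past ← cons (a, p.time, X) p.past
        match d with
        | Side.L => do
          let i ← succ p.i
          cascade I ls rs X k ⟨i, p.j, T, past⟩
        | Side.R => do
          let j ← succ p.j
          cascade I ls rs X k ⟨p.i, j, T, past⟩
      else
        pure p

/-- The direct rendezvous with the client `a` of side `d` if the server leaves the position `X` at
time `T` towards `a` while `a` moves towards the server: its time is `T + |X - X'| / (1 + v)`,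
where `X'` is the position of `a` at time `T`. -/
def direct {n : ℕ} (I : Instance n) (d : Side) (a : Fin n) (X T : ℝ)
    (past : List (Fin n × ℝ × ℝ)) : Timed (Entry n) := do
  let X' ← clientPos I d a T
  let diff ← sub X X'
  let dist ← Timed.abs diff
  let speed ← add 1 I.v
  let δ ← div dist speed
  let t ← add T δ
  let x ← clientPos I d a t
  let past' ← cons (a, t, x) past
  pure ⟨t, past'⟩

/-- If the client `oa` exists, a direct rendezvous with it is examined as a way to reach the state
`(i, j, d)`. -/
def tryDirect {n : ℕ} (I : Instance n) (M : Table n) (i j : ℕ) (d : Side) (oa : Option (Fin n))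
    (X T : ℝ) (past : List (Fin n × ℝ × ℝ)) : Timed (Table n) := do
  tick
  match oa with
  | none => pure M
  | some a => do
    let e ← direct I d a X T past
    M.relaxD i j d e

/-- All transitions from the state `(i, j, d)`. The server processes the client of the direct
rendezvous and all clients in the cascade of waiting rendezvous that it causes. If all clients are
then processed, the server returns to the origin; otherwise it leaves for a direct rendezvous with
the next client of `L` or with the next client of `R`. -/
def expand {n : ℕ} (I : Instance n) (ls rs : Array (Fin n)) (M : Table n) (i j : ℕ) (d : Side) :
    Timed (Table n) := do
  match ← M.readD i j d with
  | none => pure M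
  | some e => do
    let oa ← match d with
      | Side.L => do
        let k ← pred i
        read ls k
      | Side.R => do
        let k ← pred j
        read rs k
    match oa with
    | none => pure M
    | some a => do
      let X ← clientPos I d a e.time
      let τa ← fetch I.τ a
      let T₀ ← add e.time τa
      let p ← cascade I ls rs X n ⟨i, j, T₀, e.past⟩
      let nL ← size ls
      let nR ← size rs
      let doneL ← eq p.i nL
      let doneR ← eq p.j nR
      if doneL && doneR then
        let back ← Timed.abs X
        let t ← add p.time back
        M.relaxF d ⟨t, p.past⟩
      else
        let i' ← succ p.i
        let oℓ ← read ls p.i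
        let M₁ ← tryDirect I M i' p.j Side.L oℓ X p.time p.past
        let j' ← succ p.j
        let or ← read rs p.j
        tryDirect I M₁ p.i j' Side.R or X p.time p.past

/-- The dynamic program: all clients are sorted into the sides, the states `(1, 0, L)` and
`(0, 1, R)` are initialized with direct rendezvous of a server that leaves the origin at time `0`,
i.e. at time `|s(ℓ(1))| / (1 + v)` or `|s(r(1))| / (1 + v)`, the states are expanded in
lexicographic order, and the better one of the two final entries is returned: the minimum
makespan, and the list of the rendezvous of a schedule that attains it. The output `none` stands
for the makespan `∞`. -/
def algorithm2 {n : ℕ} (I : Instance n) : Timed (Option (Entry n)) := do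
  let as ← clients n
  let (ll, rl) ← sortSides I as
  let ls ← toArray ll
  let rs ← toArray rl
  let nL ← size ls
  let nR ← size rs
  let M₀ ← Table.init n nL nR
  let oℓ ← read ls 0
  let M₁ ← tryDirect I M₀ 1 0 Side.L oℓ 0 0 []
  let or ← read rs 0
  let M₂ ← tryDirect I M₁ 0 1 Side.R or 0 0 []
  let is ← upTo nL
  let js ← upTo nR
  let M₃ ← loop (fun M i => loop (fun M' j => do
    let M'' ← expand I ls rs M' i j Side.L
    expand I ls rs M'' i j Side.R) M js) M₂ is
  let fL ← M₃.readF Side.L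
  let fR ← M₃.readF Side.R
  match ← better fL fR with
  | none => pure none
  | some e => do
    let sched ← reverse e.past
    pure (some ⟨e.time, sched⟩)

end CLTSP

end

/-! Fix a bound `B` and ask whether a server idle at `X` at time `T` can still serve the remaining
clients and be back at the origin by `B` (`Completable`). Two exchange arguments show that the
transitions of the algorithm lose nothing.

Serving at once: if a client is served now and struck from its later place in the tour, the
rendezvous before that place are delayed by its processing time. Without deadlines this does no
harm, as the reach `v t` of a client only grows. From that place on nothing is late
(`Completable.serve`). This justifies the cascade of waiting rendezvous.

Leaving: suppose that no remaining client can have passed `X` by time `T` (`Ahead`). Let `b` be the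
first client of a completing tour and `a` the innermost remaining client on the side of `b`. After a
direct rendezvous with `a` at the point `p`, the server can still make the tour's rendezvous with
`b` in time: if that lies beyond `p`, then `p` is on the way; if it lies on the near side, then `b`,
which starts no closer than `a`, gets there so late that the server can turn back for it
(`Leaving.promising`). Hence `a` may be met, and by the first argument served, before `b`, so
prefixes of the two sorted sides suffice as states.

In a fixed state an earlier direct rendezvous is at least as good, since the server can follow the
client to the later one (`Promising.mono`); thus one entry per state is enough. Transitions increase
`(i, j)` lexicographically, so a single sweep carries a promising entry forward until there is a
final entry of time at most `B` (`Pending`, `mainLoop_spec`). Conversely, every entry records a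
feasible schedule (`Sound`, `IsTour.exists_solution`). With `B` the makespan of an arbitrary
feasible solution, the returned tour is optimal; the existence of a minimum is a by-product.

Insertion sort is quadratic. There are `O(n^2)` states, and each expansion is linear because its
cascade makes at most `n` iterations. -/

namespace CLTSP

open Timed

/-! ## The machine model -/

namespace Timed

variable {α β : Type}

@[simp] theorem pure_val (a : α) : (pure a : Timed α).val = a := rfl
@[simp] theorem pure_steps (a : α) : (pure a : Timed α).steps = 0 := rfl
@[simp] theorem bind_val (m : Timed α) (f : α → Timed β) : (m >>= f).val = (f m.val).val := rfl
@[simp] theorem bind_steps (m : Timed α) (f : α → Timed β) :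
    (m >>= f).steps = m.steps + (f m.val).steps := rfl
@[simp] theorem tick_steps : tick.steps = 1 := rfl
@[simp] theorem add_steps (a b : ℝ) : (add a b).steps = 1 := rfl
@[simp] theorem sub_steps (a b : ℝ) : (sub a b).steps = 1 := rfl
@[simp] theorem mul_steps (a b : ℝ) : (mul a b).steps = 1 := rfl
@[simp] theorem div_steps (a b : ℝ) : (div a b).steps = 1 := rfl
@[simp] theorem abs_val (a : ℝ) : (Timed.abs a).val = |a| := rfl
@[simp] theorem abs_steps (a : ℝ) : (Timed.abs a).steps = 1 := rfl
@[simp] theorem le_val (a b : ℝ) : (le a b).val = true ↔ a ≤ b := by simp [le]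
@[simp] theorem le_steps (a b : ℝ) : (le a b).steps = 1 := rfl
@[simp] theorem succ_steps (i : ℕ) : (succ i).steps = 1 := rfl
@[simp] theorem pred_val (i : ℕ) : (pred i).val = i - 1 := rfl
@[simp] theorem pred_steps (i : ℕ) : (pred i).steps = 1 := rfl
@[simp] theorem eq_val (i j : ℕ) : (eq i j).val = decide (i = j) := rfl
@[simp] theorem eq_steps (i j : ℕ) : (eq i j).steps = 1 := rfl
@[simp] theorem fetch_val {n : ℕ} (f : Fin n → ℝ) (a : Fin n) : (fetch f a).val = f a := rfl
@[simp] theorem fetch_steps {n : ℕ} (f : Fin n → ℝ) (a : Fin n) : (fetch f a).steps = 1 := rfl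
@[simp] theorem read_val (l : Array α) (i : ℕ) : (read l i).val = l[i]? := rfl
@[simp] theorem read_steps (l : Array α) (i : ℕ) : (read l i).steps = 1 := rfl
@[simp] theorem size_val (l : Array α) : (size l).val = l.size := rfl
@[simp] theorem size_steps (l : Array α) : (size l).steps = 1 := rfl
@[simp] theorem cons_val (a : α) (l : List α) : (cons a l).val = a :: l := rfl
@[simp] theorem cons_steps (a : α) (l : List α) : (cons a l).steps = 1 := rfl
@[simp] theorem upTo_val (k : ℕ) : (upTo k).val = List.range (k + 1) := rfl
@[simp] theorem upTo_steps (k : ℕ) : (upTo k).steps = k + 2 := rfl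
@[simp] theorem clients_val (n : ℕ) : (clients n).val = List.finRange n := rfl
@[simp] theorem clients_steps (n : ℕ) : (clients n).steps = n + 1 := rfl
@[simp] theorem toArray_val (l : List α) : (toArray l).val = l.toArray := rfl
@[simp] theorem toArray_steps (l : List α) : (toArray l).steps = l.length + 1 := rfl
@[simp] theorem reverse_steps (l : List α) : (reverse l).steps = l.length + 1 := rfl

theorem loop_append_val (f : β → α → Timed β) (b : β) (l l' : List α) :
    (loop f b (l ++ l')).val = (loop f (loop f b l).val l').val := by
  induction l generalizing b with
  | nil => rfl
  | cons a l ih => exact ih _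

/-- Invariants of counting loops. -/
theorem loop_range_val {f : β → ℕ → Timed β} {b : β} (P : ℕ → β → Prop) (m : ℕ) (h0 : P 0 b)
    (hs : ∀ i < m, ∀ b, P i b → P (i + 1) (f b i).val) : P m (loop f b (List.range m)).val := by
  induction m with
  | zero => exact h0
  | succ m ih =>
    rw [List.range_succ, loop_append_val]
    exact hs m (Nat.lt_succ_self m) _ (ih fun i hi => hs i (by omega))

theorem loop_steps_le {f : β → α → Timed β} {K : ℕ} (h : ∀ b a, (f b a).steps ≤ K) (b : β)
    (l : List α) : (loop f b l).steps ≤ (K + 1) * l.length := by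
  induction l generalizing b with
  | nil => simp [loop]
  | cons a l ih =>
    have h1 := h b a
    have h2 := ih (f b a).val
    simp only [loop, bind_steps, tick_steps, List.length_cons]
    linarith

end Timed

/-! ## Sorting -/

variable {n : ℕ} {I : Instance n} {ls rs : List (Fin n)}

theorem insertClient_perm (a : Fin n) (l : List (Fin n)) :
    (insertClient I a l).val.Perm (a :: l) := by
  induction l with
  | nil => simp [insertClient]
  | cons b l ih =>
    simp only [insertClient, bind_val]
    split_ifs
    · simp
    · exact (ih.cons b).trans (List.Perm.swap a b l)

theorem insertClient_pairwise (a : Fin n) (l : List (Fin n))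
    (h : l.Pairwise fun b c => |I.s b| ≤ |I.s c|) :
    (insertClient I a l).val.Pairwise fun b c => |I.s b| ≤ |I.s c| := by
  induction l with
  | nil => simp [insertClient]
  | cons b l ih =>
    have hbl := List.pairwise_cons.1 h
    simp only [insertClient, bind_val, fetch_val, abs_val, le_val]
    split_ifs with hab
    · refine List.pairwise_cons.2 ⟨fun c hc => ?_, h⟩
      rcases List.mem_cons.1 hc with rfl | hc
      · exact hab
      · exact hab.trans (hbl.1 c hc)
    · refine List.pairwise_cons.2 ⟨fun c hc => ?_, ih hbl.2⟩
      rcases List.mem_cons.1 ((insertClient_perm a l).subset hc) with rfl | hc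
      · exact (not_le.1 hab).le
      · exact hbl.1 c hc

theorem insertClient_steps_le (a : Fin n) (l : List (Fin n)) :
    (insertClient I a l).steps ≤ 6 * l.length + 1 := by
  induction l with
  | nil => simp [insertClient]
  | cons b l ih =>
    simp only [insertClient, bind_steps, fetch_steps, abs_steps, le_steps, List.length_cons]
    split_ifs
    · simp only [cons_steps]; omega
    · simp only [cons_steps, bind_steps]; omega

/-- The lists `ls` and `rs` distribute the clients to the two sides, each of them sorted by
distance from the origin. -/
structure IsSplit (I : Instance n) (ls rs : List (Fin n)) : Prop where
  perm : (ls ++ rs).Perm (List.finRange n)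
  left : ∀ a ∈ ls, I.s a ≤ 0
  right : ∀ a ∈ rs, 0 ≤ I.s a
  pairwise_left : ls.Pairwise fun a b => I.s b ≤ I.s a
  pairwise_right : rs.Pairwise fun a b => I.s a ≤ I.s b

theorem sortSides_spec (l : List (Fin n)) :
    ((sortSides I l).val.1 ++ (sortSides I l).val.2).Perm l ∧
      (∀ a ∈ (sortSides I l).val.1, I.s a ≤ 0) ∧ (∀ a ∈ (sortSides I l).val.2, 0 < I.s a) ∧
      ((sortSides I l).val.1.Pairwise fun b c => |I.s b| ≤ |I.s c|) ∧
      ((sortSides I l).val.2.Pairwise fun b c => |I.s b| ≤ |I.s c|) := by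
  induction l with
  | nil => simp [sortSides]
  | cons a l ih =>
    obtain ⟨hp, hl, hr, hpl, hpr⟩ := ih
    simp only [sortSides, bind_val, fetch_val, le_val]
    split_ifs with ha
    · refine ⟨?_, fun b hb => ?_, hr, insertClient_pairwise a _ hpl, hpr⟩
      · exact ((insertClient_perm a _).append_right _).trans (hp.cons a)
      · rcases List.mem_cons.1 ((insertClient_perm a _).subset hb) with rfl | hb
        · exact ha
        · exact hl b hb
    · refine ⟨?_, hl, fun b hb => ?_, hpl, insertClient_pairwise a _ hpr⟩
      · exact ((insertClient_perm a _).append_left _).trans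
          (List.perm_middle.trans (hp.cons a))
      · rcases List.mem_cons.1 ((insertClient_perm a _).subset hb) with rfl | hb
        · exact not_le.1 ha
        · exact hr b hb

theorem isSplit_sortSides (I : Instance n) :
    IsSplit I (sortSides I (List.finRange n)).val.1 (sortSides I (List.finRange n)).val.2 := by
  obtain ⟨hp, hl, hr, hpl, hpr⟩ := sortSides_spec (I := I) (List.finRange n)
  refine ⟨hp, hl, fun a ha => (hr a ha).le, hpl.imp_of_mem fun {a b} ha hb h => ?_,
    hpr.imp_of_mem fun {a b} ha hb h => ?_⟩
  · rw [abs_of_nonpos (hl a ha), abs_of_nonpos (hl b hb)] at h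
    linarith
  · rwa [abs_of_pos (hr a ha), abs_of_pos (hr b hb)] at h

theorem sortSides_steps_le (l : List (Fin n)) :
    (sortSides I l).steps ≤ (6 * l.length + 4) * l.length := by
  induction l with
  | nil => simp [sortSides]
  | cons a l ih =>
    have hlen := (sortSides_spec (I := I) l).1.length_eq
    rw [List.length_append] at hlen
    have h1 := insertClient_steps_le (I := I) a (sortSides I l).val.1
    have h2 := insertClient_steps_le (I := I) a (sortSides I l).val.2
    simp only [sortSides, bind_steps, fetch_steps, le_steps, tick_steps, List.length_cons]
    split_ifs
    · simp only [bind_steps, pure_steps]; nlinarith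
    · simp only [bind_steps, pure_steps]; nlinarith

/-! ## Completing a tour -/

/-- A server that is idle at the position `X` at time `T` can serve the clients of the list in this
order and return to the origin by the time `B`. -/
def CompletableList (I : Instance n) (B : ℝ) : ℝ → ℝ → List (Fin n) → Prop
  | X, T, [] => T + |X| ≤ B
  | X, T, a :: l => ∃ x t, T + |x - X| ≤ t ∧ |x - I.s a| ≤ I.v * t ∧
      CompletableList I B x (t + I.τ a) l

/-- A server that is idle at the position `X` at time `T` can serve the given clients in some order
and return to the origin by the time `B`. -/
def Completable (I : Instance n) (B X T : ℝ) (m : List (Fin n)) : Prop :=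
  ∃ l, l.Perm m ∧ CompletableList I B X T l

/-- Triangle inequality: the server can be at `X` by time `T`, and waiting is always allowed. -/
theorem CompletableList.of_move {B X T X' T' : ℝ} {l : List (Fin n)}
    (h : CompletableList I B X T l) (hm : T' + |X - X'| ≤ T) :
    CompletableList I B X' T' l := by
  cases l with
  | nil =>
    simp only [CompletableList] at h ⊢
    have := abs_sub_abs_le_abs_sub X' X
    rw [abs_sub_comm] at this
    linarith
  | cons a l =>
    obtain ⟨x, t, h1, h2, h3⟩ := h
    refine ⟨x, t, ?_, h2, h3⟩
    have := abs_sub_le x X X'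
    linarith

theorem Completable.of_move {B X T X' T' : ℝ} {m : List (Fin n)}
    (h : Completable I B X T m) (hm : T' + |X - X'| ≤ T) : Completable I B X' T' m :=
  let ⟨l, hl, hc⟩ := h
  ⟨l, hl, hc.of_move hm⟩

/-- Serving a client immediately instead of later is never a disadvantage. -/
theorem CompletableList.erase {B X T : ℝ} {l : List (Fin n)} {a : Fin n}
    (h : CompletableList I B X T l) (ha : a ∈ l) :
    CompletableList I B X (T + I.τ a) (l.erase a) := by
  induction l generalizing X T with
  | nil => simp at ha
  | cons b l ih =>
    obtain ⟨x, t, h1, h2, h3⟩ := h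
    by_cases hab : b = a
    · subst hab
      rw [List.erase_cons_head]
      -- The old rendezvous with `a` is skipped: from `X` at time `T + τ a` the server still reaches
      -- `x` by `t + τ a`, when the old tour became idle there.
      exact h3.of_move (by linarith)
    · rw [List.erase_cons_tail (by simpa using hab)]
      have hτ := mul_nonneg I.v_nonneg (I.τ_nonneg a)
      refine ⟨x, t + I.τ a, by linarith, by linarith, ?_⟩
      rw [add_right_comm]
      exact ih h3 ((List.mem_cons.1 ha).resolve_left (Ne.symm hab))

/-- Whether `a` can be at `X` at time `T` plays no role here; feasibility of the rendezvous is
tracked separately by `IsPast`. -/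
theorem Completable.serve {B X T : ℝ} {m : List (Fin n)} {a : Fin n}
    (h : Completable I B X T (a :: m)) : Completable I B X (T + I.τ a) m := by
  obtain ⟨l, hl, hc⟩ := h
  refine ⟨l.erase a, ?_, hc.erase (hl.mem_iff.2 (by simp))⟩
  simpa using hl.erase a

theorem Completable.of_perm {B X T : ℝ} {m m' : List (Fin n)} (h : Completable I B X T m)
    (hm : m.Perm m') : Completable I B X T m' :=
  let ⟨l, hl, hc⟩ := h
  ⟨l, hl.trans hm, hc⟩

/-- Every client is picked up at its initial position. This provides a finite bound, so that the
algorithm cannot end with `∞`. -/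
theorem exists_completableList (hv : 0 < I.v) (X T : ℝ) (hT : 0 ≤ T) (l : List (Fin n)) :
    ∃ B, CompletableList I B X T l := by
  induction l generalizing X T with
  | nil => exact ⟨_, le_refl (T + |X|)⟩
  | cons a l ih =>
    have ht : 0 ≤ T + |I.s a - X| := by positivity
    obtain ⟨B, hB⟩ := ih (I.s a) (T + |I.s a - X| + I.τ a) (add_nonneg ht (I.τ_nonneg a))
    exact ⟨B, I.s a, _, le_refl _, by simpa using mul_nonneg hv.le ht, hB⟩

/-! ## Partial schedules -/

/-- The position of the server after a list of rendezvous, the most recent one first. -/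
def lastPos : List (Fin n × ℝ × ℝ) → ℝ
  | [] => 0
  | (_, _, x) :: _ => x

/-- The completion time of a list of rendezvous, the most recent one first. -/
def lastTime (I : Instance n) : List (Fin n × ℝ × ℝ) → ℝ
  | [] => 0
  | (a, t, _) :: _ => t + I.τ a

/-- The given rendezvous, the most recent one first, are feasible. -/
def ValidPast (I : Instance n) : List (Fin n × ℝ × ℝ) → Prop
  | [] => True
  | (a, t, x) :: l => ValidPast I l ∧ lastTime I l + |x - lastPos l| ≤ t ∧ |x - I.s a| ≤ I.v * t

/-- The clients of `past` are `ℓ(1), ..., ℓ(i)` and `r(1), ..., r(j)`, and `past` is feasible. -/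
structure IsPast (I : Instance n) (ls rs : List (Fin n)) (i j : ℕ)
    (past : List (Fin n × ℝ × ℝ)) : Prop where
  valid : ValidPast I past
  perm : (past.map Prod.fst).Perm (ls.take i ++ rs.take j)
  le_left : i ≤ ls.length
  le_right : j ≤ rs.length

/-- No client other than `ℓ(1), ..., ℓ(i)` and `r(1), ..., r(j)` can have passed the position `X`
before time `T`. -/
structure Ahead (I : Instance n) (ls rs : List (Fin n)) (i j : ℕ) (X T : ℝ) : Prop where
  left : ∀ a ∈ ls.drop i, I.s a + I.v * T ≤ X
  right : ∀ a ∈ rs.drop j, X ≤ I.s a - I.v * T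

/-- The clients that remain after `ℓ(1), ..., ℓ(i)` and `r(1), ..., r(j)` are processed. -/
def remaining (ls rs : List (Fin n)) (i j : ℕ) : List (Fin n) := ls.drop i ++ rs.drop j

theorem drop_eq_cons {α : Type} {l : List α} {i : ℕ} {a : α} (h : l[i]? = some a) :
    l.drop i = a :: l.drop (i + 1) := by
  obtain ⟨hi, rfl⟩ := List.getElem?_eq_some_iff.1 h
  exact List.drop_eq_getElem_cons hi

theorem take_succ_eq {α : Type} {l : List α} {i : ℕ} {a : α} (h : l[i]? = some a) :
    l.take (i + 1) = l.take i ++ [a] := by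
  rw [List.take_add_one, h]; rfl

theorem remaining_left {i j : ℕ} {a : Fin n} (h : ls[i]? = some a) :
    remaining ls rs i j = a :: remaining ls rs (i + 1) j := by
  rw [remaining, drop_eq_cons h]; rfl

theorem remaining_right {i j : ℕ} {a : Fin n} (h : rs[j]? = some a) :
    (remaining ls rs i j).Perm (a :: remaining ls rs i (j + 1)) := by
  rw [remaining, drop_eq_cons h]; exact List.perm_middle

theorem IsPast.cons_left {i j : ℕ} {past : List (Fin n × ℝ × ℝ)} {a : Fin n} {t x : ℝ}
    (h : IsPast I ls rs i j past) (ha : ls[i]? = some a)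
    (ht : lastTime I past + |x - lastPos past| ≤ t) (hx : |x - I.s a| ≤ I.v * t) :
    IsPast I ls rs (i + 1) j ((a, t, x) :: past) where
  valid := ⟨h.valid, ht, hx⟩
  perm := by
    rw [take_succ_eq ha, List.append_assoc]
    exact (h.perm.cons a).trans List.perm_middle.symm
  le_left := by
    obtain ⟨hi, -⟩ := List.getElem?_eq_some_iff.1 ha
    omega
  le_right := h.le_right

theorem IsPast.cons_right {i j : ℕ} {past : List (Fin n × ℝ × ℝ)} {a : Fin n} {t x : ℝ}
    (h : IsPast I ls rs i j past) (ha : rs[j]? = some a)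
    (ht : lastTime I past + |x - lastPos past| ≤ t) (hx : |x - I.s a| ≤ I.v * t) :
    IsPast I ls rs i (j + 1) ((a, t, x) :: past) where
  valid := ⟨h.valid, ht, hx⟩
  perm := by
    rw [take_succ_eq ha, ← List.append_assoc]
    exact (h.perm.cons a).trans (List.perm_append_singleton _ _).symm
  le_left := h.le_left
  le_right := by
    obtain ⟨hi, -⟩ := List.getElem?_eq_some_iff.1 ha
    omega

/-! ## The cascade of waiting rendezvous -/

/-- After the rendezvous in `past`, the server is idle at the position `X` at time `T`. -/
structure Idle (I : Instance n) (ls rs : List (Fin n)) (X : ℝ) (p : Progress n) : Prop where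
  past : IsPast I ls rs p.i p.j p.past
  lastPos_eq : lastPos p.past = X
  lastTime_eq : lastTime I p.past = p.time
  time_nonneg : 0 ≤ p.time
  ahead : Ahead I ls rs p.i p.j X 0

theorem nextArrival_eq_none {X : ℝ} {i j : ℕ}
    (h : (nextArrival I ls.toArray rs.toArray X i j).val = none) :
    ls.length ≤ i ∧ rs.length ≤ j := by
  simp only [nextArrival, bind_val, read_val, List.getElem?_toArray] at h
  rcases ha : ls[i]? with _ | a <;> rcases hb : rs[j]? with _ | b <;> simp only [ha, hb] at h
  · simpa using And.intro ha hb
  · simp at h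
  · simp at h
  · simp only [bind_val] at h
    split_ifs at h

/-- The time at which the client `a` of side `d` arrives at `X`. -/
noncomputable def arrivalTime (I : Instance n) (d : Side) (a : Fin n) (X : ℝ) : ℝ := (arrival I d a X).val

/-- The next client of side `d`. -/
def nextClient (ls rs : List (Fin n)) (i j : ℕ) : Side → Option (Fin n)
  | Side.L => ls[i]?
  | Side.R => rs[j]?

/-- Minimality over both sides lets a single failed comparison stop the cascade. -/
theorem nextArrival_eq_some {X : ℝ} {i j : ℕ} {d : Side} {a : Fin n} {ta : ℝ}
    (h : (nextArrival I ls.toArray rs.toArray X i j).val = some (d, a, ta)) :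
    nextClient ls rs i j d = some a ∧ ta = arrivalTime I d a X ∧
      ∀ d' b, nextClient ls rs i j d' = some b → ta ≤ arrivalTime I d' b X := by
  simp only [nextArrival, bind_val, read_val, List.getElem?_toArray] at h
  rcases ha : ls[i]? with _ | a' <;> rcases hb : rs[j]? with _ | b' <;> simp only [ha, hb] at h
  · simp at h
  · simp only [bind_val, pure_val, Option.some.injEq, Prod.mk.injEq] at h
    obtain ⟨rfl, rfl, rfl⟩ := h
    refine ⟨hb, rfl, fun d' b h' => ?_⟩
    cases d' <;> simp_all [nextClient, arrivalTime]
  · simp only [bind_val, pure_val, Option.some.injEq, Prod.mk.injEq] at h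
    obtain ⟨rfl, rfl, rfl⟩ := h
    refine ⟨ha, rfl, fun d' b h' => ?_⟩
    cases d' <;> simp_all [nextClient, arrivalTime]
  · simp only [bind_val, le_val] at h
    split_ifs at h with hle <;>
      simp only [pure_val, Option.some.injEq, Prod.mk.injEq] at h <;>
      obtain ⟨rfl, rfl, rfl⟩ := h
    · refine ⟨ha, rfl, fun d' b h' => ?_⟩
      cases d' <;> simp_all [nextClient, arrivalTime]
    · refine ⟨hb, rfl, fun d' b h' => ?_⟩
      cases d' <;> simp_all [nextClient, arrivalTime, le_of_lt]

theorem arrivalTime_left (a : Fin n) (X : ℝ) :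
    arrivalTime I Side.L a X = (X - I.s a) / I.v := rfl

theorem arrivalTime_right (a : Fin n) (X : ℝ) :
    arrivalTime I Side.R a X = (I.s a - X) / I.v := rfl

theorem getElem?_mem_drop {α : Type} {l : List α} {i : ℕ} {a : α} (h : l[i]? = some a) :
    a ∈ l.drop i := by
  rw [drop_eq_cons h]; simp

/-- The server may leave `X` when no client can arrive before it becomes idle. -/
theorem IsSplit.ahead (hs : IsSplit I ls rs) (hv : 0 < I.v) {i j : ℕ} {X T : ℝ}
    (h : ∀ d a, nextClient ls rs i j d = some a → T ≤ arrivalTime I d a X) :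
    Ahead I ls rs i j X T := by
  constructor
  · intro a ha
    rcases hb : ls[i]? with _ | b
    · rw [List.drop_eq_nil_of_le (by simpa using hb)] at ha
      simp at ha
    · have h1 := h Side.L b hb
      rw [arrivalTime_left, le_div_iff₀ hv] at h1
      -- By sortedness, clients further down the list start farther out, so the bound for the next
      -- client covers them all.
      have hp := hs.pairwise_left.sublist (List.drop_sublist i ls)
      rw [drop_eq_cons hb] at hp ha
      rcases List.mem_cons.1 ha with rfl | ha
      · linarith
      · linarith [(List.pairwise_cons.1 hp).1 a ha]
  · intro a ha
    rcases hb : rs[j]? with _ | b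
    · rw [List.drop_eq_nil_of_le (by simpa using hb)] at ha
      simp at ha
    · have h1 := h Side.R b hb
      rw [arrivalTime_right, le_div_iff₀ hv] at h1
      have hp := hs.pairwise_right.sublist (List.drop_sublist j rs)
      rw [drop_eq_cons hb] at hp ha
      rcases List.mem_cons.1 ha with rfl | ha
      · linarith
      · linarith [(List.pairwise_cons.1 hp).1 a ha]

theorem Ahead.succ_left {i j : ℕ} {X T : ℝ} (h : Ahead I ls rs i j X T) :
    Ahead I ls rs (i + 1) j X T where
  left a ha := h.left a (List.drop_subset_drop_left ls (Nat.le_succ i) ha)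
  right := h.right

theorem Ahead.succ_right {i j : ℕ} {X T : ℝ} (h : Ahead I ls rs i j X T) :
    Ahead I ls rs i (j + 1) X T where
  left := h.left
  right a ha := h.right a (List.drop_subset_drop_left rs (Nat.le_succ j) ha)

/-- During a cascade waiting clients may already have been able to pass `X`, so only `Ahead` at time
`0` is maintained. It says that `a` starts to the left of `X`; its distance to `X` is therefore `X -
s a`, which it has covered by its arrival time. -/
theorem Idle.serve_left (hv : 0 < I.v) {X : ℝ} {p : Progress n} (h : Idle I ls rs X p) {a : Fin n}
    (ha : ls[p.i]? = some a) (hle : arrivalTime I Side.L a X ≤ p.time) :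
    Idle I ls rs X ⟨p.i + 1, p.j, p.time + I.τ a, (a, p.time, X) :: p.past⟩ where
  past := by
    refine h.past.cons_left ha (by simp [h.lastPos_eq, h.lastTime_eq]) ?_
    have := h.ahead.left a (getElem?_mem_drop ha)
    rw [arrivalTime_left, div_le_iff₀ hv] at hle
    rw [abs_of_nonneg (by linarith)]
    linarith
  lastPos_eq := rfl
  lastTime_eq := rfl
  time_nonneg := add_nonneg h.time_nonneg (I.τ_nonneg a)
  ahead := h.ahead.succ_left

theorem Idle.serve_right (hv : 0 < I.v) {X : ℝ} {p : Progress n} (h : Idle I ls rs X p)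
    {a : Fin n} (ha : rs[p.j]? = some a) (hle : arrivalTime I Side.R a X ≤ p.time) :
    Idle I ls rs X ⟨p.i, p.j + 1, p.time + I.τ a, (a, p.time, X) :: p.past⟩ where
  past := by
    refine h.past.cons_right ha (by simp [h.lastPos_eq, h.lastTime_eq]) ?_
    have := h.ahead.right a (getElem?_mem_drop ha)
    rw [arrivalTime_right, div_le_iff₀ hv] at hle
    rw [abs_of_nonpos (by linarith)]
    linarith
  lastPos_eq := rfl
  lastTime_eq := rfl
  time_nonneg := add_nonneg h.time_nonneg (I.τ_nonneg a)
  ahead := h.ahead.succ_right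

/-- What the cascade guarantees about the progress `q` that it makes from `p`. -/
structure CascadeSpec (I : Instance n) (ls rs : List (Fin n)) (X : ℝ) (p q : Progress n) :
    Prop where
  idle : Idle I ls rs X q
  ahead : Ahead I ls rs q.i q.j X q.time
  le_left : p.i ≤ q.i
  le_right : p.j ≤ q.j
  completable : ∀ B, Completable I B X p.time (remaining ls rs p.i p.j) →
    Completable I B X q.time (remaining ls rs q.i q.j)

/-- Each iteration uses one unit of fuel and one client, and `Completable.serve` preserves
completability. When the loop stops with clients left, the earliest arrival is after the idle time,
which restores `Ahead` at that time. -/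
theorem cascade_spec (hs : IsSplit I ls rs) (hv : 0 < I.v) (X : ℝ) (k : ℕ) (p : Progress n)
    (h : Idle I ls rs X p) (hk : ls.length + rs.length ≤ p.i + p.j + k) :
    CascadeSpec I ls rs X p (cascade I ls.toArray rs.toArray X k p).val := by
  induction k generalizing p with
  | zero =>
    -- Without fuel, `hk` forces both lists to be exhausted, and `Ahead` is vacuous.
    have := h.past.le_left
    have := h.past.le_right
    refine ⟨h, ?_, le_rfl, le_rfl, fun B => id⟩
    refine ⟨fun a ha => ?_, fun a ha => ?_⟩
    · rw [cascade, pure_val, List.drop_eq_nil_of_le (by omega)] at ha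
      simp at ha
    · rw [cascade, pure_val, List.drop_eq_nil_of_le (by omega)] at ha
      simp at ha
  | succ k ih =>
    simp only [cascade, bind_val]
    rcases hn : (nextArrival I ls.toArray rs.toArray X p.i p.j).val with _ | ⟨d, a, ta⟩
    · obtain ⟨h1, h2⟩ := nextArrival_eq_none hn
      refine ⟨h, ?_, le_rfl, le_rfl, fun B => id⟩
      refine ⟨fun a ha => ?_, fun a ha => ?_⟩
      · rw [pure_val, List.drop_eq_nil_of_le h1] at ha
        simp at ha
      · rw [pure_val, List.drop_eq_nil_of_le h2] at ha
        simp at ha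
    · obtain ⟨ha, rfl, hmin⟩ := nextArrival_eq_some hn
      simp only [bind_val, le_val]
      split_ifs with hle
      · cases d with
        | L =>
          have hi := ih _ (h.serve_left hv ha hle) (by simp only; omega)
          refine ⟨hi.idle, hi.ahead, (Nat.le_succ _).trans hi.le_left, hi.le_right,
            fun B hB => hi.completable B ?_⟩
          rw [remaining_left ha] at hB
          exact hB.serve
        | R =>
          have hi := ih _ (h.serve_right hv ha hle) (by simp only; omega)
          refine ⟨hi.idle, hi.ahead, hi.le_left, (Nat.le_succ _).trans hi.le_right,
            fun B hB => hi.completable B ?_⟩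
          exact (hB.of_perm (remaining_right ha)).serve
      · exact ⟨h, hs.ahead hv fun d' b hb => (not_le.1 hle).le.trans (hmin d' b hb),
          le_rfl, le_rfl, fun B => id⟩

theorem nextArrival_steps_le (ls rs : Array (Fin n)) (X : ℝ) (i j : ℕ) :
    (nextArrival I ls rs X i j).steps ≤ 9 := by
  simp only [nextArrival, bind_steps, read_steps]
  split <;> simp [arrival]
  split_ifs <;> simp

/-- An iteration costs at most `15`: loop overhead, at most `9` for the next arrival, and five for
the comparison, fetching and adding `τ`, recording the rendezvous and advancing an index. -/
theorem cascade_steps_le (ls rs : Array (Fin n)) (X : ℝ) (k : ℕ) (p : Progress n) :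
    (cascade I ls rs X k p).steps ≤ 15 * k := by
  induction k generalizing p with
  | zero => simp [cascade]
  | succ k ih =>
    have hn := nextArrival_steps_le (I := I) ls rs X p.i p.j
    simp only [cascade, bind_steps, tick_steps]
    split
    · simp; omega
    · simp only [bind_steps, le_steps]
      split_ifs
      · split <;> simp only [bind_steps, fetch_steps, add_steps, cons_steps, succ_steps] <;>
          grind
      · simp; omega

/-! ## Direct rendezvous -/

/-- The position at time `T` of the client `a` of side `d` if it moves towards the other side. -/
noncomputable def meetPos (I : Instance n) (d : Side) (a : Fin n) (T : ℝ) : ℝ :=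
  (clientPos I d a T).val

/-- The time of the direct rendezvous of a server that leaves `X` at time `T`. -/
noncomputable def meetTime (I : Instance n) (d : Side) (a : Fin n) (X T : ℝ) : ℝ :=
  T + |X - meetPos I d a T| / (1 + I.v)

theorem meetPos_left (a : Fin n) (T : ℝ) : meetPos I Side.L a T = I.s a + I.v * T := rfl

theorem meetPos_right (a : Fin n) (T : ℝ) : meetPos I Side.R a T = I.s a - I.v * T := rfl

theorem direct_val (d : Side) (a : Fin n) (X T : ℝ) (past : List (Fin n × ℝ × ℝ)) :
    (direct I d a X T past).val = ⟨meetTime I d a X T,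
      (a, meetTime I d a X T, meetPos I d a (meetTime I d a X T)) :: past⟩ := rfl

theorem le_meetTime (d : Side) (a : Fin n) (X T : ℝ) : T ≤ meetTime I d a X T := by
  have := I.v_nonneg
  have : 0 ≤ |X - meetPos I d a T| / (1 + I.v) := by positivity
  rw [meetTime]
  linarith

/-- The gap closes at rate `1 + v`, so the server travels left at full speed from `T` until the
meeting. -/
theorem meetPos_meetTime_left {a : Fin n} {X T : ℝ} (h : I.s a + I.v * T ≤ X) :
    meetPos I Side.L a (meetTime I Side.L a X T) = X - (meetTime I Side.L a X T - T) := by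
  have hv := I.v_nonneg
  rw [meetTime, meetPos_left, meetPos_left, abs_of_nonneg (by linarith)]
  field_simp
  ring

theorem meetPos_meetTime_right {a : Fin n} {X T : ℝ} (h : X ≤ I.s a - I.v * T) :
    meetPos I Side.R a (meetTime I Side.R a X T) = X + (meetTime I Side.R a X T - T) := by
  have hv := I.v_nonneg
  rw [meetTime, meetPos_right, meetPos_right, abs_of_nonpos (by linarith)]
  field_simp
  ring

theorem abs_meetPos_sub (d : Side) (a : Fin n) {T : ℝ} (hT : 0 ≤ T) :
    |meetPos I d a T - I.s a| ≤ I.v * T := by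
  have := mul_nonneg I.v_nonneg hT
  cases d
  · rw [meetPos_left, add_sub_cancel_left, abs_of_nonneg this]
  · rw [meetPos_right, sub_sub_cancel_left, abs_neg, abs_of_nonneg this]

theorem abs_meetPos_sub_meetPos (d : Side) (a : Fin n) {T T' : ℝ} (hT : T ≤ T') :
    |meetPos I d a T' - meetPos I d a T| = I.v * (T' - T) := by
  have := mul_nonneg I.v_nonneg (sub_nonneg.2 hT)
  cases d
  · rw [meetPos_left, meetPos_left, ← abs_of_nonneg this]; congr 1; ring
  · rw [meetPos_right, meetPos_right, ← abs_of_nonneg this, ← abs_neg]; congr 1; ring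

/-- The server leaves the position `X` at time `T` after the rendezvous in `past`. -/
structure Leaving (I : Instance n) (ls rs : List (Fin n)) (i j : ℕ) (X T : ℝ)
    (past : List (Fin n × ℝ × ℝ)) : Prop where
  isPast : IsPast I ls rs i j past
  lastPos_eq : lastPos past = X
  lastTime_eq : lastTime I past = T
  time_nonneg : 0 ≤ T
  ahead : Ahead I ls rs i j X T

/-- The client of the direct rendezvous of a state. -/
def lastClient (ls rs : List (Fin n)) (i j : ℕ) : Side → Option (Fin n)
  | Side.L => ls[i - 1]?
  | Side.R => rs[j - 1]?

/-- The entry is that of a schedule whose last rendezvous is the direct rendezvous of the state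
`(i, j, d)`. -/
structure IsEntry (I : Instance n) (ls rs : List (Fin n)) (i j : ℕ) (d : Side)
    (e : Entry n) : Prop where
  past : IsPast I ls rs i j e.past
  time_nonneg : 0 ≤ e.time
  exists_client : ∃ a l, lastClient ls rs i j d = some a ∧
    e.past = (a, e.time, meetPos I d a e.time) :: l ∧
    Ahead I ls rs i j (meetPos I d a e.time) e.time

/-- From the direct rendezvous of the state `(i, j, d)` at time `t`, the tour can be completed by
the time `B`. -/
def Promising (I : Instance n) (ls rs : List (Fin n)) (B : ℝ) (i j : ℕ) (d : Side) (t : ℝ) :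
    Prop :=
  ∃ a, lastClient ls rs i j d = some a ∧
    Completable I B (meetPos I d a t) t (a :: remaining ls rs i j)

/-- From the earlier rendezvous the server can follow the client, whose speed is at most `1`, to the
later one. Hence keeping only the minimum in each cell is enough. -/
theorem Promising.mono (hv : I.v ≤ 1) {B : ℝ} {i j : ℕ} {d : Side} {t t' : ℝ}
    (h : Promising I ls rs B i j d t) (ht : t' ≤ t) : Promising I ls rs B i j d t' := by
  obtain ⟨a, ha, hc⟩ := h
  refine ⟨a, ha, hc.of_move ?_⟩
  rw [abs_meetPos_sub_meetPos d a ht]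
  nlinarith

/-- `Ahead` survives the move: the other left clients trail `a` by sortedness, and the right clients
advance no faster than the server retreats from them. -/
theorem Leaving.isEntry_left (hs : IsSplit I ls rs) (hv : I.v ≤ 1) {i j : ℕ} {X T : ℝ}
    {past : List (Fin n × ℝ × ℝ)} (h : Leaving I ls rs i j X T past) {a : Fin n}
    (ha : ls[i]? = some a) :
    IsEntry I ls rs (i + 1) j Side.L (direct I Side.L a X T past).val := by
  have h1 := le_meetTime (I := I) Side.L a X T
  have h2 := meetPos_meetTime_left (h.ahead.left a (getElem?_mem_drop ha))
  have h0 := h.time_nonneg.trans h1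
  have hvt : I.v * (meetTime I Side.L a X T - T) ≤ meetTime I Side.L a X T - T :=
    mul_le_of_le_one_left (sub_nonneg.2 h1) hv
  rw [direct_val]
  refine ⟨?_, h0, a, past, ha, rfl, ?_⟩
  · refine h.isPast.cons_left ha ?_ (abs_meetPos_sub _ _ h0)
    rw [h.lastPos_eq, h.lastTime_eq, h2, sub_sub_cancel_left, abs_neg,
      abs_of_nonneg (sub_nonneg.2 h1)]
    linarith
  · constructor
    · intro b hb
      have hp := hs.pairwise_left.sublist (List.drop_sublist i ls)
      rw [drop_eq_cons ha] at hp
      have := (List.pairwise_cons.1 hp).1 b hb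
      rw [meetPos_left]
      linarith
    · intro b hb
      have := h.ahead.right b hb
      rw [h2]
      linarith

theorem Leaving.isEntry_right (hs : IsSplit I ls rs) (hv : I.v ≤ 1) {i j : ℕ} {X T : ℝ}
    {past : List (Fin n × ℝ × ℝ)} (h : Leaving I ls rs i j X T past) {a : Fin n}
    (ha : rs[j]? = some a) :
    IsEntry I ls rs i (j + 1) Side.R (direct I Side.R a X T past).val := by
  have h1 := le_meetTime (I := I) Side.R a X T
  have h2 := meetPos_meetTime_right (h.ahead.right a (getElem?_mem_drop ha))
  have h0 := h.time_nonneg.trans h1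
  have hvt : I.v * (meetTime I Side.R a X T - T) ≤ meetTime I Side.R a X T - T :=
    mul_le_of_le_one_left (sub_nonneg.2 h1) hv
  rw [direct_val]
  refine ⟨?_, h0, a, past, ha, rfl, ?_⟩
  · refine h.isPast.cons_right ha ?_ (abs_meetPos_sub _ _ h0)
    rw [h.lastPos_eq, h.lastTime_eq, h2, add_sub_cancel_left, abs_of_nonneg (sub_nonneg.2 h1)]
    linarith
  · constructor
    · intro b hb
      have := h.ahead.left b hb
      rw [h2]
      linarith
    · intro b hb
      have hp := hs.pairwise_right.sublist (List.drop_sublist j rs)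
      rw [drop_eq_cons ha] at hp
      have := (List.pairwise_cons.1 hp).1 b hb
      rw [meetPos_right]
      linarith

theorem exists_getElem?_of_mem_drop {α : Type} {l : List α} {i : ℕ} {b : α} (h : b ∈ l.drop i) :
    ∃ a, l[i]? = some a ∧ (b = a ∨ b ∈ l.drop (i + 1)) := by
  rcases ha : l[i]? with _ | a
  · rw [List.drop_eq_nil_of_le (by simpa using ha)] at h
    simp at h
  · rw [drop_eq_cons ha] at h
    exact ⟨a, rfl, List.mem_cons.1 h⟩

/-- If the tour can be completed, then it can be completed from the direct rendezvous with the
next client of one of the two sides. -/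
theorem Leaving.promising (hs : IsSplit I ls rs) (hv : I.v ≤ 1) {i j : ℕ} {X T : ℝ}
    {past : List (Fin n × ℝ × ℝ)} (h : Leaving I ls rs i j X T past) {B : ℝ}
    (hr : i < ls.length ∨ j < rs.length) (hc : Completable I B X T (remaining ls rs i j)) :
    (∃ a, ls[i]? = some a ∧
        Promising I ls rs B (i + 1) j Side.L (direct I Side.L a X T past).val.time) ∨
      ∃ a, rs[j]? = some a ∧
        Promising I ls rs B i (j + 1) Side.R (direct I Side.R a X T past).val.time := by
  obtain ⟨l, hl, hc⟩ := hc
  rcases l with _ | ⟨b, l⟩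
  · have := hl.length_eq
    simp only [remaining, List.length_nil, List.length_append, List.length_drop] at this
    omega
  have hb : b ∈ remaining ls rs i j := hl.subset (by simp)
  obtain ⟨x, t, h1, h2, h3⟩ := hc
  obtain ⟨h4, h5⟩ := abs_le.1 h2
  rcases List.mem_append.1 hb with hb | hb
  · obtain ⟨a, ha, hab⟩ := exists_getElem?_of_mem_drop hb
    have h6 := le_meetTime (I := I) Side.L a X T
    have h7 := meetPos_meetTime_left (h.ahead.left a (getElem?_mem_drop ha))
    have h8 : I.s b ≤ I.s a := by
      rcases hab with rfl | hab
      · exact le_rfl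
      · have hp := hs.pairwise_left.sublist (List.drop_sublist i ls)
        rw [drop_eq_cons ha] at hp
        exact (List.pairwise_cons.1 hp).1 b hab
    -- The completing tour is kept as it is, with `b` first and `a` still unserved; only its
    -- starting point changes.
    refine Or.inl ⟨a, ha, a, ha, b :: l, ?_, x, t, ?_, h2, h3⟩
    · exact hl.trans (by rw [remaining_left ha])
    rw [direct_val]
    simp only
    -- If `x` is to the left of the meeting point, that point is on the way from `X` to `x`.
    -- Otherwise `x ≤ s b + v t ≤ s a + v t` bounds the way back by `v` times the time left.
    rcases le_total x (meetPos I Side.L a (meetTime I Side.L a X T)) with hx | hx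
    · rw [abs_of_nonpos (by linarith)]
      have := neg_abs_le (x - X)
      linarith
    · rw [abs_of_nonneg (by linarith)]
      rw [meetPos_left] at hx h7 ⊢
      have h9 : 0 ≤ I.v * (t - meetTime I Side.L a X T) := by linarith
      rcases le_total (meetTime I Side.L a X T) t with h10 | h10
      · have := mul_le_of_le_one_left (sub_nonneg.2 h10) hv
        linarith
      -- Here `x` must be the meeting point itself, and the server cannot be there before the direct
      -- rendezvous.
      · have := mul_nonpos_of_nonneg_of_nonpos I.v_nonneg (sub_nonpos.2 h10)
        have := neg_abs_le (x - X)
        linarith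
  · obtain ⟨a, ha, hab⟩ := exists_getElem?_of_mem_drop hb
    have h6 := le_meetTime (I := I) Side.R a X T
    have h7 := meetPos_meetTime_right (h.ahead.right a (getElem?_mem_drop ha))
    have h8 : I.s a ≤ I.s b := by
      rcases hab with rfl | hab
      · exact le_rfl
      · have hp := hs.pairwise_right.sublist (List.drop_sublist j rs)
        rw [drop_eq_cons ha] at hp
        exact (List.pairwise_cons.1 hp).1 b hab
    refine Or.inr ⟨a, ha, a, ha, b :: l, hl.trans (remaining_right ha), x, t, ?_, h2, h3⟩
    rw [direct_val]
    simp only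
    rcases le_total (meetPos I Side.R a (meetTime I Side.R a X T)) x with hx | hx
    · rw [abs_of_nonneg (by linarith)]
      have := le_abs_self (x - X)
      linarith
    · rw [abs_of_nonpos (by linarith)]
      rw [meetPos_right] at hx h7 ⊢
      have h9 : 0 ≤ I.v * (t - meetTime I Side.R a X T) := by linarith
      rcases le_total (meetTime I Side.R a X T) t with h10 | h10
      · have := mul_le_of_le_one_left (sub_nonneg.2 h10) hv
        linarith
      · have := mul_nonpos_of_nonneg_of_nonpos I.v_nonneg (sub_nonpos.2 h10)
        have := le_abs_self (x - X)
        linarith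

/-! ## The table -/

theorem better_some_val (o : Option (Entry n)) (e : Entry n) :
    ∃ r, (better o (some e)).val = some r ∧ r.time ≤ e.time ∧
      (∀ e', o = some e' → r.time ≤ e'.time) ∧ (r = e ∨ o = some r) := by
  rcases o with _ | e'
  · exact ⟨e, rfl, le_rfl, by simp, Or.inl rfl⟩
  · simp only [better, bind_val, le_val]
    split_ifs with h
    · exact ⟨e', rfl, h, by simp, Or.inr rfl⟩
    · exact ⟨e, rfl, le_rfl, by simpa using (not_le.1 h).le, Or.inl rfl⟩

theorem better_steps (o o' : Option (Entry n)) : (better o o').steps = 1 := by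
  rcases o with _ | e <;> rcases o' with _ | e' <;> simp [better]
  split_ifs <;> rfl

namespace Table

@[simp] theorem readD_val (M : Table n) (i j : ℕ) (d : Side) : (M.readD i j d).val = M.D i j d :=
  rfl
@[simp] theorem readD_steps (M : Table n) (i j : ℕ) (d : Side) : (M.readD i j d).steps = 1 := rfl
@[simp] theorem readF_val (M : Table n) (d : Side) : (M.readF d).val = M.F d := rfl
@[simp] theorem readF_steps (M : Table n) (d : Side) : (M.readF d).steps = 1 := rfl

/-- The entries of `M'` are at most those of `M`. -/
structure Improves (M M' : Table n) : Prop where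
  D : ∀ i j d e, M.D i j d = some e → ∃ e', M'.D i j d = some e' ∧ e'.time ≤ e.time
  F : ∀ d e, M.F d = some e → ∃ e', M'.F d = some e' ∧ e'.time ≤ e.time

theorem Improves.refl (M : Table n) : Improves M M :=
  ⟨fun _ _ _ e h => ⟨e, h, le_rfl⟩, fun _ e h => ⟨e, h, le_rfl⟩⟩

theorem Improves.trans {M₁ M₂ M₃ : Table n} (h : Improves M₁ M₂) (h' : Improves M₂ M₃) :
    Improves M₁ M₃ := by
  refine ⟨fun i j d e he => ?_, fun d e he => ?_⟩
  · obtain ⟨e₂, he₂, h₂⟩ := h.D i j d e he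
    obtain ⟨e₃, he₃, h₃⟩ := h'.D i j d e₂ he₂
    exact ⟨e₃, he₃, h₃.trans h₂⟩
  · obtain ⟨e₂, he₂, h₂⟩ := h.F d e he
    obtain ⟨e₃, he₃, h₃⟩ := h'.F d e₂ he₂
    exact ⟨e₃, he₃, h₃.trans h₂⟩

theorem relaxD_spec (M : Table n) (i j : ℕ) (d : Side) (e : Entry n) :
    Improves M (M.relaxD i j d e).val ∧
      (∃ e', (M.relaxD i j d e).val.D i j d = some e' ∧ e'.time ≤ e.time) ∧
      (∀ i' j' d' e', (M.relaxD i j d e).val.D i' j' d' = some e' →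
        M.D i' j' d' = some e' ∨ i' = i ∧ j' = j ∧ d' = d ∧ e' = e) ∧
      (M.relaxD i j d e).val.F = M.F := by
  obtain ⟨r, hr, h1, h2, h3⟩ := better_some_val (M.D i j d) e
  have hD : ∀ i' j' d', (M.relaxD i j d e).val.D i' j' d' =
      if i' = i ∧ j' = j ∧ d' = d then some r else M.D i' j' d' := by
    intro i' j' d'
    rw [← hr]
    rfl
  refine ⟨⟨fun i' j' d' e' he' => ?_, fun _ e' he' => ⟨e', he', le_rfl⟩⟩, ⟨r, by simp [hD], h1⟩,
    fun i' j' d' e' he' => ?_, rfl⟩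
  · rw [hD]
    split_ifs with h
    · obtain ⟨rfl, rfl, rfl⟩ := h
      exact ⟨r, rfl, h2 e' he'⟩
    · exact ⟨e', he', le_rfl⟩
  · rw [hD] at he'
    split_ifs at he' with h
    · obtain ⟨rfl, rfl, rfl⟩ := h
      obtain rfl := Option.some.inj he'
      rcases h3 with h3 | h3
      · exact Or.inr ⟨rfl, rfl, rfl, h3⟩
      · exact Or.inl h3
    · exact Or.inl he'

theorem relaxF_spec (M : Table n) (d : Side) (e : Entry n) :
    Improves M (M.relaxF d e).val ∧
      (∃ e', (M.relaxF d e).val.F d = some e' ∧ e'.time ≤ e.time) ∧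
      (∀ d' e', (M.relaxF d e).val.F d' = some e' → M.F d' = some e' ∨ e' = e) ∧
      (M.relaxF d e).val.D = M.D := by
  obtain ⟨r, hr, h1, h2, h3⟩ := better_some_val (M.F d) e
  have hF : ∀ d', (M.relaxF d e).val.F d' = if d' = d then some r else M.F d' := by
    intro d'
    rw [← hr]
    rfl
  refine ⟨⟨fun _ _ _ e' he' => ⟨e', he', le_rfl⟩, fun d' e' he' => ?_⟩, ⟨r, by simp [hF], h1⟩,
    fun d' e' he' => ?_, rfl⟩
  · rw [hF]
    split_ifs with h
    · subst h
      exact ⟨r, rfl, h2 e' he'⟩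
    · exact ⟨e', he', le_rfl⟩
  · rw [hF] at he'
    split_ifs at he' with h
    · subst h
      obtain rfl := Option.some.inj he'
      exact h3.symm
    · exact Or.inl he'

theorem relaxD_steps (M : Table n) (i j : ℕ) (d : Side) (e : Entry n) :
    (M.relaxD i j d e).steps = 3 := by
  simp [relaxD, better_steps, writeD]

theorem relaxF_steps (M : Table n) (d : Side) (e : Entry n) : (M.relaxF d e).steps = 3 := by
  simp [relaxF, better_steps, writeF]

end Table

/-- The final entry is that of a tour through all clients. -/
structure IsTour (I : Instance n) (e : Entry n) : Prop where
  valid : ValidPast I e.past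
  perm : (e.past.map Prod.fst).Perm (List.finRange n)
  time_eq : e.time = lastTime I e.past + |lastPos e.past|

/-- All entries of the table are those of feasible schedules. -/
structure Sound (I : Instance n) (ls rs : List (Fin n)) (M : Table n) : Prop where
  D : ∀ i j d e, M.D i j d = some e → IsEntry I ls rs i j d e
  F : ∀ d e, M.F d = some e → IsTour I e

theorem Sound.relaxD {M : Table n} (h : Sound I ls rs M) {i j : ℕ} {d : Side} {e : Entry n}
    (he : IsEntry I ls rs i j d e) : Sound I ls rs (M.relaxD i j d e).val := by
  obtain ⟨-, -, h1, h2⟩ := M.relaxD_spec i j d e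
  refine ⟨fun i' j' d' e' he' => ?_, fun d' e' he' => h.F d' e' (h2 ▸ he')⟩
  rcases h1 i' j' d' e' he' with h' | ⟨rfl, rfl, rfl, rfl⟩
  · exact h.D _ _ _ _ h'
  · exact he

theorem Sound.relaxF {M : Table n} (h : Sound I ls rs M) {d : Side} {e : Entry n}
    (he : IsTour I e) : Sound I ls rs (M.relaxF d e).val := by
  obtain ⟨-, -, h1, h2⟩ := M.relaxF_spec d e
  refine ⟨fun i' j' d' e' he' => h.D _ _ _ _ (h2 ▸ he'), fun d' e' he' => ?_⟩
  rcases h1 d' e' he' with h' | rfl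
  · exact h.F _ _ h'
  · exact he

theorem tryDirect_spec {M : Table n} (hM : Sound I ls rs M) {i j : ℕ} {d : Side}
    {oa : Option (Fin n)} {X T : ℝ} {past : List (Fin n × ℝ × ℝ)}
    (h : ∀ a, oa = some a → IsEntry I ls rs i j d (direct I d a X T past).val) :
    Sound I ls rs (tryDirect I M i j d oa X T past).val ∧
      M.Improves (tryDirect I M i j d oa X T past).val ∧
      ∀ a, oa = some a → ∃ e, (tryDirect I M i j d oa X T past).val.D i j d = some e ∧
        e.time ≤ (direct I d a X T past).val.time := by
  rcases oa with _ | a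
  · exact ⟨hM, .refl M, by simp⟩
  · obtain ⟨h1, h2, -, -⟩ := M.relaxD_spec i j d (direct I d a X T past).val
    refine ⟨hM.relaxD (h a rfl), h1, fun b hb => ?_⟩
    obtain rfl := Option.some.inj hb
    exact h2

/-- The table after both direct rendezvous have been examined. -/
noncomputable def afterLeaving (I : Instance n) (ls rs : List (Fin n)) (M : Table n) (i j : ℕ)
    (X T : ℝ) (past : List (Fin n × ℝ × ℝ)) : Table n :=
  (tryDirect I (tryDirect I M (i + 1) j Side.L ls[i]? X T past).val i (j + 1) Side.R rs[j]?
    X T past).val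

theorem Leaving.afterLeaving_spec (hs : IsSplit I ls rs) (hv : I.v ≤ 1) {M : Table n}
    (hM : Sound I ls rs M) {i j : ℕ} {X T : ℝ} {past : List (Fin n × ℝ × ℝ)}
    (h : Leaving I ls rs i j X T past) :
    Sound I ls rs (afterLeaving I ls rs M i j X T past) ∧
      M.Improves (afterLeaving I ls rs M i j X T past) ∧
      ∀ B, (i < ls.length ∨ j < rs.length) → Completable I B X T (remaining ls rs i j) →
        ∃ i' j' d' e, (afterLeaving I ls rs M i j X T past).D i' j' d' = some e ∧
          Promising I ls rs B i' j' d' e.time ∧ (i < i' ∨ i = i' ∧ j < j') := by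
  obtain ⟨s1, m1, e1⟩ := tryDirect_spec hM fun a ha => h.isEntry_left hs hv ha
  obtain ⟨s2, m2, e2⟩ := tryDirect_spec s1 fun a ha => h.isEntry_right hs hv ha
  refine ⟨s2, m1.trans m2, fun B hr hc => ?_⟩
  rcases h.promising hs hv hr hc with ⟨a, ha, hp⟩ | ⟨a, ha, hp⟩
  · obtain ⟨e, he, hle⟩ := e1 a ha
    obtain ⟨e', he', hle'⟩ := m2.D _ _ _ _ he
    exact ⟨_, _, _, e', he', hp.mono hv (hle'.trans hle), Or.inl (Nat.lt_succ_self i)⟩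
  · obtain ⟨e, he, hle⟩ := e2 a ha
    exact ⟨_, _, _, e, he, hp.mono hv hle, Or.inr ⟨rfl, Nat.lt_succ_self j⟩⟩

/-- There is a final entry of time at most `B`. -/
def Finished (B : ℝ) (M : Table n) : Prop := ∃ d e, M.F d = some e ∧ e.time ≤ B

/-- The transitions from a state with the entry `e` and the client `a` of the direct rendezvous. -/
noncomputable def expandClient (I : Instance n) (ls rs : Array (Fin n)) (M : Table n) (i j : ℕ)
    (d : Side) (e : Entry n) (a : Fin n) : Timed (Table n) := do
  let X ← clientPos I d a e.time
  let τa ← fetch I.τ a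
  let T₀ ← add e.time τa
  let p ← cascade I ls rs X n ⟨i, j, T₀, e.past⟩
  let nL ← size ls
  let nR ← size rs
  let doneL ← eq p.i nL
  let doneR ← eq p.j nR
  if doneL && doneR then
    let back ← Timed.abs X
    let t ← add p.time back
    M.relaxF d ⟨t, p.past⟩
  else
    let i' ← succ p.i
    let oℓ ← read ls p.i
    let M₁ ← tryDirect I M i' p.j Side.L oℓ X p.time p.past
    let j' ← succ p.j
    let or ← read rs p.j
    tryDirect I M₁ p.i j' Side.R or X p.time p.past

theorem expand_val_of_none {M : Table n} {i j : ℕ} {d : Side} (h : M.D i j d = none)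
    (ls rs : Array (Fin n)) : (expand I ls rs M i j d).val = M := by
  simp [expand, h]

theorem expand_val_of_some {M : Table n} {i j : ℕ} {d : Side} {e : Entry n} {a : Fin n}
    (h : M.D i j d = some e) (ha : lastClient ls rs i j d = some a) :
    (expand I ls.toArray rs.toArray M i j d).val =
      (expandClient I ls.toArray rs.toArray M i j d e a).val := by
  cases d <;> simp only [lastClient] at ha <;>
    simp only [expand, bind_val, Table.readD_val, h, pred_val, read_val, List.getElem?_toArray,
      ha] <;> rfl

/-- Completability passes through the service of the direct client, the cascade and the choice of
the next direct rendezvous. The cascade never lowers `i` or `j` and the next rendezvous raises one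
of them, so the new state is lexicographically larger. -/
theorem expand_spec (hs : IsSplit I ls rs) (hv0 : 0 < I.v) (hv : I.v ≤ 1) {M : Table n}
    (hM : Sound I ls rs M) (i j : ℕ) (d : Side) :
    Sound I ls rs (expand I ls.toArray rs.toArray M i j d).val ∧
      M.Improves (expand I ls.toArray rs.toArray M i j d).val ∧
      ∀ B e, M.D i j d = some e → Promising I ls rs B i j d e.time →
        Finished B (expand I ls.toArray rs.toArray M i j d).val ∨
        ∃ i' j' d' e', (expand I ls.toArray rs.toArray M i j d).val.D i' j' d' = some e' ∧
          Promising I ls rs B i' j' d' e'.time ∧ (i < i' ∨ i = i' ∧ j < j') := by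
  rcases he : M.D i j d with _ | e
  · rw [expand_val_of_none he]
    exact ⟨hM, .refl M, by simp⟩
  obtain ⟨hpast, ht, a, l, ha, hl, hah⟩ := hM.D i j d e he
  rw [expand_val_of_some he ha]
  simp only [expandClient, bind_val]
  have hidle : Idle I ls rs (meetPos I d a e.time) ⟨i, j, e.time + I.τ a, e.past⟩ := by
    refine ⟨hpast, by rw [hl]; rfl, by rw [hl]; rfl, add_nonneg ht (I.τ_nonneg a), ?_⟩
    have := mul_nonneg I.v_nonneg ht
    exact ⟨fun b hb => by linarith [hah.left b hb], fun b hb => by linarith [hah.right b hb]⟩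
  have hlen : ls.length + rs.length = n := by simpa using hs.perm.length_eq
  have hc := cascade_spec hs hv0 _ n _ hidle (by simp only; omega)
  change CascadeSpec I ls rs (meetPos I d a e.time) _
    (cascade I ls.toArray rs.toArray (clientPos I d a e.time).val n
      ⟨i, j, (add e.time (fetch I.τ a).val).val, e.past⟩).val at hc
  generalize (cascade I ls.toArray rs.toArray (clientPos I d a e.time).val n
      ⟨i, j, (add e.time (fetch I.τ a).val).val, e.past⟩).val = q at hc ⊢
  have hcomp : ∀ B e', some e = some e' → Promising I ls rs B i j d e'.time →
      Completable I B (meetPos I d a e.time) q.time (remaining ls rs q.i q.j) := by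
    intro B e' hee' hp
    obtain rfl := Option.some.inj hee'
    obtain ⟨b, hb, hp⟩ := hp
    obtain rfl := Option.some.inj (ha.symm.trans hb)
    exact hc.completable B hp.serve
  have hi := hc.idle
  simp only [size_val, eq_val, List.size_toArray, Bool.and_eq_true, decide_eq_true_eq]
  split_ifs with hdone
  · have htour : IsTour I ⟨q.time + |meetPos I d a e.time|, q.past⟩ := by
      refine ⟨hi.past.valid, ?_, by rw [hi.lastPos_eq, hi.lastTime_eq]⟩
      have := hi.past.perm
      rw [hdone.1, hdone.2, List.take_length, List.take_length] at this
      exact this.trans hs.perm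
    obtain ⟨h1, ⟨e', he', hle'⟩, -, -⟩ :=
      M.relaxF_spec d ⟨q.time + |meetPos I d a e.time|, q.past⟩
    refine ⟨hM.relaxF htour, h1, fun B e₀ he₀ hp => Or.inl ⟨d, e', he', hle'.trans ?_⟩⟩
    -- With no client remaining, completability is just the inequality for the way home.
    obtain ⟨l', hl', hc'⟩ := hcomp B e₀ he₀ hp
    rw [remaining, hdone.1, hdone.2, List.drop_length, List.drop_length] at hl'
    obtain rfl := hl'.eq_nil
    exact hc'
  · have hleave : Leaving I ls rs q.i q.j (meetPos I d a e.time) q.time q.past :=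
      ⟨hi.past, hi.lastPos_eq, hi.lastTime_eq, hi.time_nonneg, hc.ahead⟩
    obtain ⟨s, m, p⟩ := hleave.afterLeaving_spec hs hv hM
    have hval : afterLeaving I ls rs M q.i q.j (meetPos I d a e.time) q.time q.past =
      (tryDirect I (tryDirect I M (q.i + 1) q.j Side.L ls.toArray[q.i]?
        (meetPos I d a e.time) q.time q.past).val q.i (q.j + 1) Side.R rs.toArray[q.j]?
        (meetPos I d a e.time) q.time q.past).val := by
      simp only [afterLeaving, List.getElem?_toArray]
    rw [hval] at s m p
    refine ⟨s, m, fun B e₀ he₀ hp => Or.inr ?_⟩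
    have h1 := hi.past.le_left
    have h2 := hi.past.le_right
    obtain ⟨i', j', d', e', he', hp', hlt⟩ := p B (by omega) (hcomp B e₀ he₀ hp)
    refine ⟨i', j', d', e', he', hp', ?_⟩
    have h3 := hc.le_left
    have h4 := hc.le_right
    simp only at h3 h4
    omega

theorem direct_steps (d : Side) (a : Fin n) (X T : ℝ) (past : List (Fin n × ℝ × ℝ)) :
    (direct I d a X T past).steps = 12 := by
  cases d <;> simp [direct, clientPos]

theorem tryDirect_steps_le (M : Table n) (i j : ℕ) (d : Side) (oa : Option (Fin n)) (X T : ℝ)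
    (past : List (Fin n × ℝ × ℝ)) : (tryDirect I M i j d oa X T past).steps ≤ 16 := by
  cases oa <;> simp [tryDirect, direct_steps, Table.relaxD_steps]

theorem expandClient_steps_le (ls rs : Array (Fin n)) (M : Table n) (i j : ℕ) (d : Side)
    (e : Entry n) (a : Fin n) : (expandClient I ls rs M i j d e a).steps ≤ 15 * n + 45 := by
  have hpos : (clientPos I d a e.time).steps = 3 := by
    cases d <;> simp [clientPos]
  simp only [expandClient, bind_steps, hpos, fetch_steps, add_steps, size_steps, eq_steps]
  have hc := cascade_steps_le (I := I) ls rs (clientPos I d a e.time).val n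
    ⟨i, j, (add e.time (fetch I.τ a).val).val, e.past⟩
  split_ifs
  · simp only [bind_steps, abs_steps, add_steps, Table.relaxF_steps]
    omega
  · simp only [bind_steps, succ_steps, read_steps]
    grw [tryDirect_steps_le, tryDirect_steps_le, hc]
    omega

/-- The constant `48` is absorbed using `n ≥ 1`: `15 n + 48 ≤ 63 n`. -/
theorem expand_steps_le (hn : 0 < n) (ls rs : Array (Fin n)) (M : Table n) (i j : ℕ) (d : Side) :
    (expand I ls rs M i j d).steps ≤ 63 * n := by
  have h : (expand I ls rs M i j d).steps ≤ 15 * n + 48 := by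
    simp only [expand, bind_steps, Table.readD_steps, Table.readD_val]
    split
    · simp
    · rename_i e _
      have hc := expandClient_steps_le (I := I) ls rs M i j d e
      cases d <;> simp only [bind_steps, pred_steps, read_steps] <;> split
      · simp
      · rename_i a _
        have := hc a
        simp only [expandClient] at this
        omega
      · simp
      · rename_i a _
        have := hc a
        simp only [expandClient] at this
        omega
  omega

/-! ## The loops of the dynamic program -/

/-- The tour can be completed by the time `B` from an entry that is not lexicographically before
`(i, j)`, or it is already completed. -/
def Pending (I : Instance n) (ls rs : List (Fin n)) (B : ℝ) (i j : ℕ) (M : Table n) : Prop :=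
  Finished B M ∨ ∃ i' j' d e, M.D i' j' d = some e ∧ Promising I ls rs B i' j' d e.time ∧
    (i < i' ∨ i = i' ∧ j ≤ j')

theorem Finished.mono {B : ℝ} {M M' : Table n} (h : Finished B M) (hM : M.Improves M') :
    Finished B M' := by
  obtain ⟨d, e, he, hle⟩ := h
  obtain ⟨e', he', hle'⟩ := hM.F d e he
  exact ⟨d, e', he', hle'.trans hle⟩

theorem Pending.mono (hv : I.v ≤ 1) {B : ℝ} {i j : ℕ} {M M' : Table n}
    (h : Pending I ls rs B i j M) (hM : M.Improves M') : Pending I ls rs B i j M' := by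
  rcases h with h | ⟨i', j', d, e, he, hp, hlt⟩
  · exact Or.inl (h.mono hM)
  · obtain ⟨e', he', hle⟩ := hM.D _ _ _ _ he
    exact Or.inr ⟨i', j', d, e', he', hp.mono hv hle, hlt⟩

/-- The expansion of the states `(i, j, L)` and `(i, j, R)`. -/
noncomputable def expandBoth (I : Instance n) (ls rs : Array (Fin n)) (i : ℕ) (M : Table n)
    (j : ℕ) : Timed (Table n) := do
  let M' ← expand I ls rs M i j Side.L
  expand I ls rs M' i j Side.R

theorem expandBoth_spec (hs : IsSplit I ls rs) (hv0 : 0 < I.v) (hv : I.v ≤ 1) {M : Table n}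
    (hM : Sound I ls rs M) (i j : ℕ) :
    Sound I ls rs (expandBoth I ls.toArray rs.toArray i M j).val ∧
      ∀ B, Pending I ls rs B i j M →
        Pending I ls rs B i (j + 1) (expandBoth I ls.toArray rs.toArray i M j).val := by
  obtain ⟨s1, m1, p1⟩ := expand_spec hs hv0 hv hM i j Side.L
  obtain ⟨s2, m2, p2⟩ := expand_spec hs hv0 hv s1 i j Side.R
  refine ⟨s2, fun B hB => ?_⟩
  rcases hB with hB | ⟨i', j', d, e, he, hp, hlt⟩
  · exact Or.inl (hB.mono (m1.trans m2))
  by_cases h : i' = i ∧ j' = j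
  · obtain ⟨rfl, rfl⟩ := h
    cases d with
    | L =>
      rcases p1 B e he hp with h | ⟨i₁, j₁, d₁, e₁, he₁, hp₁, hlt₁⟩
      · exact Or.inl (h.mono m2)
      · exact Pending.mono hv (Or.inr ⟨i₁, j₁, d₁, e₁, he₁, hp₁, by omega⟩) m2
    | R =>
      -- Expanding the `L` state first can only improve the entry of the `R` state.
      obtain ⟨e₁, he₁, hle⟩ := m1.D _ _ _ _ he
      rcases p2 B e₁ he₁ (hp.mono hv hle) with h | ⟨i₁, j₁, d₁, e₂, he₂, hp₂, hlt₁⟩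
      · exact Or.inl h
      · exact Or.inr ⟨i₁, j₁, d₁, e₂, he₂, hp₂, by omega⟩
  · exact Pending.mono hv (Or.inr ⟨i', j', d, e, he, hp, by omega⟩) (m1.trans m2)

/-- The main loop of the dynamic program. -/
noncomputable def mainLoop (I : Instance n) (ls rs : Array (Fin n)) (M : Table n)
    (is js : List ℕ) : Timed (Table n) :=
  loop (fun M i => loop (fun M' j => do
    let M'' ← expand I ls rs M' i j Side.L
    expand I ls rs M'' i j Side.R) M js) M is

theorem mainLoop_spec (hs : IsSplit I ls rs) (hv0 : 0 < I.v) (hv : I.v ≤ 1) {M : Table n}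
    (hM : Sound I ls rs M) :
    Sound I ls rs (mainLoop I ls.toArray rs.toArray M (List.range (ls.length + 1))
        (List.range (rs.length + 1))).val ∧
      ∀ B, Pending I ls rs B 0 0 M →
        Finished B (mainLoop I ls.toArray rs.toArray M (List.range (ls.length + 1))
          (List.range (rs.length + 1))).val := by
  have h := loop_range_val
    (f := fun M i => loop (expandBoth I ls.toArray rs.toArray i) M (List.range (rs.length + 1)))
    (fun i M' => Sound I ls rs M' ∧ ∀ B, Pending I ls rs B 0 0 M → Pending I ls rs B i 0 M')
    (ls.length + 1) ⟨hM, fun _ => id⟩ (fun i _ M₁ h₁ => ?_)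
  · refine ⟨h.1, fun B hB => ?_⟩
    rcases h.2 B hB with h' | ⟨i', j', d, e, he, -, hlt⟩
    · exact h'
    -- A pending entry would lie in a row beyond the last one, which soundness excludes.
    · have := (h.1.D _ _ _ _ he).past.le_left
      omega
  · have h := loop_range_val (f := expandBoth I ls.toArray rs.toArray i)
      (fun j M' => Sound I ls rs M' ∧ ∀ B, Pending I ls rs B i 0 M₁ → Pending I ls rs B i j M')
      (rs.length + 1) ⟨h₁.1, fun _ => id⟩ (fun j _ M₂ h₂ => ?_)
    · refine ⟨h.1, fun B hB => ?_⟩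
      rcases h.2 B (h₁.2 B hB) with h' | ⟨i', j', d, e, he, hp, hlt⟩
      · exact Or.inl h'
      -- No entry lies beyond the end of row `i`, so what is pending there is pending from `(i + 1,
      -- 0)`.
      · have := (h.1.D _ _ _ _ he).past.le_right
        exact Or.inr ⟨i', j', d, e, he, hp, by omega⟩
    · obtain ⟨s, p⟩ := expandBoth_spec hs hv0 hv h₂.1 i j
      exact ⟨s, fun B hB => p B (h₂.2 B hB)⟩

theorem mainLoop_steps_le (hn : 0 < n) (ls rs : Array (Fin n)) (M : Table n) (is js : List ℕ) :
    (mainLoop I ls rs M is js).steps ≤ ((126 * n + 1) * js.length + 1) * is.length := by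
  refine loop_steps_le (fun M i => loop_steps_le (fun M j => ?_) M js) M is
  have h1 := expand_steps_le (I := I) hn ls rs M i j Side.L
  have h2 := expand_steps_le (I := I) hn ls rs (expand I ls rs M i j Side.L).val i j Side.R
  simp only [bind_steps]
  omega

/-! ## Schedules and solutions -/

theorem ValidPast.drop {l : List (Fin n × ℝ × ℝ)} (h : ValidPast I l) (k : ℕ) :
    ValidPast I (l.drop k) := by
  induction k generalizing l with
  | zero => exact h
  | succ k ih =>
    rcases l with _ | ⟨⟨a, t, x⟩, l⟩
    · exact h
    · exact ih h.1

/-- A feasible list of rendezvous with all clients is the schedule of a feasible solution. -/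
theorem IsTour.exists_solution (hv : 0 < I.v) (hI : I.NoTimeConstraints) {e : Entry n}
    (h : IsTour I e) :
    ∃ S : Solution n, I.Feasible S ∧ S.schedule = e.past.reverse ∧ I.makespan S = e.time := by
  have hlen : e.past.reverse.length = n := by simpa using h.perm.length_eq
  have hnd : (e.past.reverse.map Prod.fst).Nodup := by
    rw [List.map_reverse, List.nodup_reverse]
    exact h.perm.nodup_iff.2 (List.nodup_finRange n)
  let f : Fin n → Fin n := fun k => (e.past.reverse[k.1]'(by omega)).1
  have hf : Function.Injective f := by
    intro k m hkm
    refine Fin.ext ((hnd.getElem_inj_iff (i := k.1) (j := m.1) (hi := by simp at hlen ⊢; omega)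
      (hj := by simp at hlen ⊢; omega)).1 ?_)
    simpa only [List.getElem_map] using hkm
  let σ : Equiv.Perm (Fin n) := Equiv.ofBijective f (Finite.injective_iff_bijective.1 hf)
  let S : Solution n :=
    { order := σ
      time := fun a => (e.past.reverse[(σ.symm a).1]'(by omega)).2.1
      pos := fun a => (e.past.reverse[(σ.symm a).1]'(by omega)).2.2
      finish := e.time }
  have hS : ∀ (k : ℕ) (hk : k < n), (S.order ⟨k, hk⟩, S.time (S.order ⟨k, hk⟩),
      S.pos (S.order ⟨k, hk⟩)) = e.past.reverse[k]'(by omega) := by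
    intro k hk
    simp only [S, Equiv.symm_apply_apply]
    rfl
  -- As `past` lists the latest rendezvous first, its suffix `past.drop (n - k)` consists of the
  -- first `k` rendezvous.
  have hdrop : ∀ (k : ℕ) (hk : k < n), e.past.drop (n - (k + 1)) = (S.order ⟨k, hk⟩,
      S.time (S.order ⟨k, hk⟩), S.pos (S.order ⟨k, hk⟩)) :: e.past.drop (n - k) := by
    intro k hk
    rw [List.length_reverse] at hlen
    rw [hS k hk, List.getElem_reverse, List.drop_eq_getElem_cons (by omega),
      show n - (k + 1) + 1 = n - k by omega]
    congr 2
    omega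
  have hcx : ∀ k ≤ n, I.c S k = lastTime I (e.past.drop (n - k)) ∧
      S.x k = lastPos (e.past.drop (n - k)) := by
    intro k hk
    cases k with
    | zero =>
      rw [List.drop_eq_nil_of_le (by simp at hlen ⊢; omega)]
      exact ⟨rfl, rfl⟩
    | succ k =>
      rw [hdrop k hk]
      simp [Instance.c, Solution.x, lastTime, lastPos, Nat.lt_of_succ_le hk]
  have hvalid : ∀ (k : ℕ) (hk : k < n), ValidPast I ((S.order ⟨k, hk⟩,
      S.time (S.order ⟨k, hk⟩), S.pos (S.order ⟨k, hk⟩)) :: e.past.drop (n - k)) := by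
    intro k hk
    rw [← hdrop k hk]
    exact h.valid.drop _
  have hclient : ∀ a, |S.pos a - I.s a| ≤ I.v * S.time a := by
    intro a
    have := (hvalid (S.order.symm a).1 (S.order.symm a).2).2.2
    simpa using this
  have htime : ∀ a, 0 ≤ S.time a := fun a =>
    nonneg_of_mul_nonneg_right ((abs_nonneg _).trans (hclient a)) hv
  refine ⟨S, ⟨fun k hk => ?_, fun a => ?_, fun a => ?_, fun a => ?_⟩, ?_, ?_⟩
  · obtain ⟨h1, h2⟩ := hcx k hk
    rw [h1, h2]
    rcases hk.lt_or_eq with hk | rfl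
    · simpa [Solution.x, Solution.t, hk] using (hvalid k hk).2.1
    · simp [Solution.x, Solution.t, S, h.time_eq]
  · rw [(hI a).1, zero_add, div_le_iff₀ hv, mul_comm]
    exact hclient a
  · rw [(hI a).1]
    exact htime a
  · rw [(hI a).2]
    exact le_top
  · refine List.ext_getElem (by simp [Solution.schedule] at hlen ⊢; omega) fun k hk _ => ?_
    have hk' : k < n := by simpa [Solution.schedule] using hk
    rw [← hS k hk']
    simp [Solution.schedule]
  · simp [Instance.makespan, Instance.c, S]

/-- A feasible solution completes the tour by its makespan. -/
theorem Instance.Feasible.completable (hv : 0 < I.v) (hI : I.NoTimeConstraints) {S : Solution n}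
    (h : I.Feasible S) : Completable I (I.makespan S) 0 0 (List.finRange n) := by
  -- Backward induction along the tour; `m` counts the clients still to be served.
  have key : ∀ m k, k + m = n → CompletableList I (I.makespan S) (S.x k) (I.c S k)
      ((List.ofFn S.order).drop k) := by
    intro m
    induction m with
    | zero =>
      intro k hk
      obtain rfl : k = n := hk
      rw [List.drop_eq_nil_of_le (by simp)]
      simpa [CompletableList, Solution.x, Solution.t, Instance.makespan, Instance.c]
        using h.server k le_rfl
    | succ m ih =>
      intro k hk
      have hkn : k < n := by omega
      rw [List.drop_eq_getElem_cons (by simpa using hkn), List.getElem_ofFn]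
      refine ⟨S.x (k + 1), S.t (k + 1), h.server k hkn.le, ?_, ?_⟩
      · have := h.client (S.order ⟨k, hkn⟩)
        rw [(hI _).1, zero_add, div_le_iff₀ hv, mul_comm] at this
        simpa [Solution.x, Solution.t, hkn] using this
      · have := ih (k + 1) (by omega)
        simpa [Solution.t, Instance.c, hkn] using this
  refine ⟨List.ofFn S.order, ?_, by simpa [Solution.x, Instance.c] using key n 0 (zero_add n)⟩
  rw [List.perm_ext_iff_of_nodup (List.nodup_ofFn.2 S.order.injective) (List.nodup_finRange n)]
  intro a
  simpa using ⟨S.order.symm a, by simp⟩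

/-! ## The algorithm -/

/-- The algorithm after sorting. -/
noncomputable def solveSorted (I : Instance n) (ls rs : List (Fin n)) : Table n :=
  (mainLoop I ls.toArray rs.toArray
    (afterLeaving I ls rs ⟨fun _ _ _ => none, fun _ => none⟩ 0 0 0 0 [])
    (List.range (ls.length + 1)) (List.range (rs.length + 1))).val

/-- Initialization is an ordinary departure from the origin at time `0`, where `Ahead` reduces to
the signs of the `s a`; `n > 0` provides a client to leave for. -/
theorem solveSorted_spec (hn : 0 < n) (hs : IsSplit I ls rs) (hv0 : 0 < I.v) (hv : I.v ≤ 1) :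
    Sound I ls rs (solveSorted I ls rs) ∧
      ∀ B, Completable I B 0 0 (List.finRange n) → Finished B (solveSorted I ls rs) := by
  have hlen : ls.length + rs.length = n := by simpa using hs.perm.length_eq
  have hl : Leaving I ls rs 0 0 0 0 [] := by
    refine ⟨⟨trivial, by simp, Nat.zero_le _, Nat.zero_le _⟩, rfl, rfl, le_rfl, ?_⟩
    exact ⟨fun a ha => by simpa using hs.left a (by simpa using ha),
      fun a ha => by simpa using hs.right a (by simpa using ha)⟩
  have h0 : Sound I ls rs (⟨fun _ _ _ => none, fun _ => none⟩ : Table n) := by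
    constructor <;> simp
  obtain ⟨s, -, p⟩ := hl.afterLeaving_spec hs hv h0
  obtain ⟨s', p'⟩ := mainLoop_spec hs hv0 hv s
  refine ⟨s', fun B hB => p' B (Or.inr ?_)⟩
  obtain ⟨i, j, d, e, he, hp, hlt⟩ := p B (by omega) (hB.of_perm hs.perm.symm)
  exact ⟨i, j, d, e, he, hp, by omega⟩

theorem better_val_spec {o o' : Option (Entry n)} {P : Entry n → Prop} (ho : ∀ e, o = some e → P e)
    (ho' : ∀ e, o' = some e → P e) :
    (∀ e, (better o o').val = some e → P e) ∧
      ∀ B e, (o = some e ∨ o' = some e) → e.time ≤ B →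
        ∃ r, (better o o').val = some r ∧ r.time ≤ B := by
  rcases o' with _ | e'
  · have : (better o none).val = o := by cases o <;> rfl
    rw [this]
    exact ⟨ho, fun B e he hB => ⟨e, by simpa using he, hB⟩⟩
  · obtain ⟨r, hr, h1, h2, h3⟩ := better_some_val o e'
    rw [hr]
    refine ⟨fun e he => ?_, fun B e he hB => ⟨r, rfl, ?_⟩⟩
    · obtain rfl := Option.some.inj he
      rcases h3 with rfl | h3
      · exact ho' _ rfl
      · exact ho _ h3
    · rcases he with he | he
      · exact (h2 e he).trans hB
      · obtain rfl := Option.some.inj he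
        exact h1.trans hB

/-- The best final entry. -/
noncomputable def bestEntry (I : Instance n) : Option (Entry n) :=
  (better
    ((solveSorted I (sortSides I (List.finRange n)).val.1
      (sortSides I (List.finRange n)).val.2).F Side.L)
    ((solveSorted I (sortSides I (List.finRange n)).val.1
      (sortSides I (List.finRange n)).val.2).F Side.R)).val

theorem exists_bestEntry (hn : 0 < n) (hv0 : 0 < I.v) (hv : I.v ≤ 1) :
    ∃ e, bestEntry I = some e ∧ IsTour I e ∧
      ∀ B, Completable I B 0 0 (List.finRange n) → e.time ≤ B := by
  obtain ⟨s, f⟩ := solveSorted_spec hn (isSplit_sortSides I) hv0 hv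
  obtain ⟨h1, h2⟩ := better_val_spec (s.F Side.L) (s.F Side.R)
  have h3 : ∀ B, Completable I B 0 0 (List.finRange n) →
      ∃ r, bestEntry I = some r ∧ r.time ≤ B := by
    intro B hB
    obtain ⟨d, e, he, hle⟩ := f B hB
    refine h2 B e ?_ hle
    cases d
    · exact Or.inl he
    · exact Or.inr he
  obtain ⟨B, hB⟩ := exists_completableList hv0 0 0 le_rfl (List.finRange n)
  obtain ⟨e, he, -⟩ := h3 B ⟨_, .refl _, hB⟩
  refine ⟨e, he, h1 e he, fun B' hB' => ?_⟩
  obtain ⟨r, hr, hle⟩ := h3 B' hB'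
  obtain rfl := Option.some.inj (he.symm.trans hr)
  exact hle

theorem algorithm2_val (I : Instance n) :
    (algorithm2 I).val = (bestEntry I).map fun e => ⟨e.time, e.past.reverse⟩ := by
  unfold algorithm2
  simp only [bind_val, clients_val, toArray_val, upTo_val, Table.readF_val, size_val,
    List.size_toArray, read_val]
  generalize hb : (better _ _).val = o
  have h : bestEntry I = o := by
    rw [← hb]
    simp only [bestEntry, solveSorted, mainLoop, afterLeaving, List.getElem?_toArray]
    rfl
  rw [h]
  cases o <;> rfl

/-- The left side has the shape left by unfolding the steps. With `nL + 1, nR + 1 ≤ 2 n` the main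
loop contributes `504 n ^ 3` to leading order; the lower-order terms fit easily below `1000 n ^ 3`.
-/
theorem algorithm2_steps_bound (hn : 0 < n) {nL nR : ℕ} (hl : nL + nR = n) :
    n + 1 + ((6 * n + 4) * n + (nL + 1 + (nR + 1 + (1 + (1 +
      (2 * (nL + 1) * (nR + 1) + 2 + (1 + (16 + (1 + (16 + (nL + 2 + (nR + 2 +
        (((126 * n + 1) * (nR + 1) + 1) * (nL + 1) +
          (1 + (1 + (1 + (n + 1 + 0))))))))))))))))) ≤ 1000 * n ^ 3 := by
  have h1 : nL + 1 ≤ 2 * n := by omega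
  have h2 : nR + 1 ≤ 2 * n := by omega
  have h3 : 2 * (nL + 1) * (nR + 1) ≤ 2 * (2 * n) * (2 * n) := by gcongr
  have h4 : ((126 * n + 1) * (nR + 1) + 1) * (nL + 1) ≤
      ((126 * n + 1) * (2 * n) + 1) * (2 * n) := by gcongr
  have h5 : n ≤ n ^ 3 := Nat.le_self_pow (by norm_num) n
  have h6 : n ^ 2 ≤ n ^ 3 := Nat.pow_le_pow_right hn (by norm_num)
  have h7 : ((126 * n + 1) * (2 * n) + 1) * (2 * n) = 504 * n ^ 3 + 4 * n ^ 2 + 2 * n := by ring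
  have h8 : 2 * (2 * n) * (2 * n) = 8 * n ^ 2 := by ring
  have h9 : (6 * n + 4) * n = 6 * n ^ 2 + 4 * n := by ring
  linarith

theorem algorithm2_steps_le (hn : 0 < n) {e : Entry n} (he : bestEntry I = some e)
    (hlen : e.past.length = n) : (algorithm2 I).steps ≤ 1000 * n ^ 3 := by
  have hloop := fun ls rs M is js => mainLoop_steps_le (I := I) hn ls rs M is js
  simp only [mainLoop] at hloop
  have hl := (isSplit_sortSides I).perm.length_eq
  rw [List.length_append, List.length_finRange] at hl
  unfold algorithm2
  simp only [clients_val, toArray_val, upTo_val, Table.readF_val, size_val, List.size_toArray,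
    read_val, bind_steps, clients_steps, toArray_steps, upTo_steps, Table.readF_steps,
    size_steps, read_steps, better_steps]
  generalize hb : (better _ _).val = o
  have h : bestEntry I = o := by
    rw [← hb]
    simp only [bestEntry, solveSorted, mainLoop, afterLeaving, List.getElem?_toArray]
    rfl
  rw [← h, he]
  simp only [bind_steps, pure_steps, reverse_steps, hlen]
  grw [hloop, tryDirect_steps_le, tryDirect_steps_le, sortSides_steps_le]
  simp only [List.length_range, List.length_finRange, Table.init]
  exact algorithm2_steps_bound hn hl

end CLTSP

theorem mainTheorem3 :
    ∃ C : ℕ, ∀ (n : ℕ) (_ : 0 < n) (I : CLTSP.Instance n),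
      I.SlowClients → I.NoTimeConstraints →
        (∃ S : CLTSP.Solution n, I.IsOptimal S ∧
          (CLTSP.algorithm2 I).val = some ⟨I.makespan S, S.schedule⟩) ∧
        (CLTSP.algorithm2 I).steps ≤ C * n ^ 3 := by
  refine ⟨1000, fun n hn I hI hT => ?_⟩
  obtain ⟨e, he, htour, hmin⟩ := CLTSP.exists_bestEntry hn hI.1 hI.2.le
  obtain ⟨S, hS, hsched, hspan⟩ := htour.exists_solution hI.1 hT
  refine ⟨⟨S, ⟨hS, fun S' hS' => ?_⟩, ?_⟩, ?_⟩
  · rw [hspan]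
    -- The competitor's makespan serves as the bound `B`.
    exact hmin _ (hS'.completable hI.1 hT)
  · rw [CLTSP.algorithm2_val, he, hspan, hsched]
    rfl
  · exact CLTSP.algorithm2_steps_le hn he (by simpa using htour.perm.length_eq)
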